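/- Let $p\in(1/2,1]$ and $q=1-p$. For $n\ge 1$, consider the asymmetric simple exclusion process (ASEP) of $n$ particles on $\mathbb{Z}$ with jump rates $p$ to the right and $q$ to the left: each particle attempts to jump one step to the right at rate $p$ and one step to the left at rate $q$, independently of the others, and a jump onto an occupied site is cancelled. Let $\hat\eta_1(t)<\hat\eta_2(t)<\dots<\hat\eta_n(t)$ denote the positions of the particles at time $t$, and take the initial condition $\hat\eta_i(0)=i$ for $i=1,\dots,n$. **Proposition.** For every $K>0$ there exists a constant $C=C(p,K)>0$ such that, for every sequence of integers $(n_N)_{N\ge1}$ with $1\le n_N\le N$, the ASEP with $n=n_N$ particles satisfies $$\lim_{N\to\infty}\mathbb{P}\Big[\forall t\in[0,KN],\ \forall i\in\{1,\dots,n\}:\ |\hat\eta_i(t)-(p-q)t|\le C\sqrt N\,\max\big(\sqrt n,(\log N)^{10}\big)\Big]=1 .$$ -/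

import Mathlib

open MeasureTheory Filter Topology
open scoped NNReal

namespace ASEP

/-- Configurations of `n` particles on `ℤ`, listed from left to right:
`x 0 < x 1 < ⋯ < x (n-1)`. As a subtype of `Fin n → ℤ` it carries the discrete topology and
the corresponding Borel (that is, discrete) σ-algebra. -/
abbrev Config (n : ℕ) : Type := {x : Fin n → ℤ // StrictMono x}

theorem strictMono_update_right {n : ℕ} {x : Fin n → ℤ} (hx : StrictMono x) (i : Fin n)
    (h : ∀ j, x j ≠ x i + 1) : StrictMono (Function.update x i (x i + 1)) := by
  intro a b hab
  have h1 := hx hab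
  have h2 := h b
  by_cases ha : a = i
  · subst ha
    have hb : b ≠ a := ne_of_gt hab
    rw [Function.update_self, Function.update_of_ne hb]
    omega
  · by_cases hb : b = i
    · subst hb
      rw [Function.update_self, Function.update_of_ne ha]
      omega
    · rw [Function.update_of_ne ha, Function.update_of_ne hb]
      exact h1

theorem strictMono_update_left {n : ℕ} {x : Fin n → ℤ} (hx : StrictMono x) (i : Fin n)
    (h : ∀ j, x j ≠ x i - 1) : StrictMono (Function.update x i (x i - 1)) := by
  intro a b hab
  have h1 := hx hab
  have h2 := h a
  by_cases ha : a = i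
  · subst ha
    have hb : b ≠ a := ne_of_gt hab
    rw [Function.update_self, Function.update_of_ne hb]
    omega
  · by_cases hb : b = i
    · subst hb
      rw [Function.update_self, Function.update_of_ne ha]
      omega
    · rw [Function.update_of_ne ha, Function.update_of_ne hb]
      exact h1

/-- The `i`-th particle attempts a jump one step to the right; the jump is cancelled if the target
site is occupied. -/
def moveRight {n : ℕ} (i : Fin n) (x : Config n) : Config n :=
  if h : ∀ j, x.1 j ≠ x.1 i + 1 then
    ⟨Function.update x.1 i (x.1 i + 1), strictMono_update_right x.2 i h⟩
  else x

/-- The `i`-th particle attempts a jump one step to the left; the jump is cancelled if the target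
site is occupied. -/
def moveLeft {n : ℕ} (i : Fin n) (x : Config n) : Config n :=
  if h : ∀ j, x.1 j ≠ x.1 i - 1 then
    ⟨Function.update x.1 i (x.1 i - 1), strictMono_update_left x.2 i h⟩
  else x

/-- The generator `L` of the asymmetric simple exclusion process of `n` particles on `ℤ`, with jump
rate `p` to the right and `q` to the left. -/
def generator (p q : ℝ) {n : ℕ} (f : Config n → ℝ) (x : Config n) : ℝ :=
  ∑ i : Fin n, (p * (f (moveRight i x) - f x) + q * (f (moveLeft i x) - f x))

/-- The Markov semigroup `exp (t L) = ∑ₖ (t ^ k / k!) L ^ k` of the (bounded) generator `L`, acting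
on bounded functions; see `summable_semigroup` for the convergence of the series. -/
noncomputable def semigroup (p q : ℝ) {n : ℕ} (t : ℝ) (f : Config n → ℝ) (x : Config n) : ℝ :=
  ∑' k : ℕ, t ^ k / (Nat.factorial k : ℝ) * (generator p q)^[k] f x

theorem abs_generator_iterate_le (p q : ℝ) {n : ℕ} {f : Config n → ℝ} {B : ℝ}
    (hf : ∀ x, |f x| ≤ B) (k : ℕ) (x : Config n) :
    |(generator p q)^[k] f x| ≤ (n * (2 * |p| + 2 * |q|)) ^ k * B := by
  induction k generalizing x with
  | zero => simpa using hf x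
  | succ k ih =>
    rw [Function.iterate_succ_apply']
    set g := (generator p q)^[k] f
    set D := ((n : ℝ) * (2 * |p| + 2 * |q|)) ^ k * B
    have h2 : ∀ y z, |g y - g z| ≤ 2 * D := fun y z =>
      (abs_sub _ _).trans (by linarith [ih y, ih z])
    calc |generator p q g x|
        ≤ ∑ i : Fin n, |p * (g (moveRight i x) - g x) + q * (g (moveLeft i x) - g x)| :=
          Finset.abs_sum_le_sum_abs _ _
      _ ≤ ∑ _i : Fin n, (|p| * (2 * D) + |q| * (2 * D)) := by
          refine Finset.sum_le_sum fun i _ => (abs_add_le _ _).trans ?_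
          rw [abs_mul, abs_mul]
          gcongr <;> exact h2 _ _
      _ = _ := by
          simp only [Finset.sum_const, Finset.card_univ, Fintype.card_fin, nsmul_eq_mul, D]
          ring

theorem summable_semigroup (p q : ℝ) {n : ℕ} (t : ℝ) {f : Config n → ℝ} {B : ℝ}
    (hf : ∀ x, |f x| ≤ B) (x : Config n) :
    Summable fun k : ℕ => t ^ k / (Nat.factorial k : ℝ) * (generator p q)^[k] f x := by
  refine Summable.of_norm_bounded
    ((Real.summable_pow_div_factorial (|t| * (n * (2 * |p| + 2 * |q|)))).mul_right B) fun k => ?_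
  rw [Real.norm_eq_abs, abs_mul, abs_div, abs_pow, Nat.abs_cast, mul_pow]
  calc _ ≤ |t| ^ k / (Nat.factorial k : ℝ) * ((n * (2 * |p| + 2 * |q|)) ^ k * B) := by
        gcongr
        exact abs_generator_iterate_le p q hf k x
    _ = _ := by ring

/-- The σ-algebra generated by the process `η` up to time `s`. -/
abbrev past {Ω : Type*} {n : ℕ} (η : ℝ≥0 → Ω → Config n) (s : ℝ≥0) : MeasurableSpace Ω :=
  ⨆ u ≤ s, MeasurableSpace.comap (η u) inferInstance

/-- `η` is, under `P`, an asymmetric simple exclusion process of `n` particles on `ℤ` with jump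
rate `p` to the right and `q` to the left, started from `x₀`: the right-continuous (hence piecewise
constant) Markov process with generator `generator p q` and initial configuration `x₀`. -/
structure IsASEP {Ω : Type*} [MeasurableSpace Ω] (P : Measure Ω) (p q : ℝ) {n : ℕ}
    (x₀ : Config n) (η : ℝ≥0 → Ω → Config n) : Prop where
  measurable : ∀ t, Measurable (η t)
  rightCont : ∀ᵐ ω ∂P, ∀ t, ContinuousWithinAt (fun s => η s ω) (Set.Ici t) t
  start : ∀ᵐ ω ∂P, η 0 ω = x₀
  markov : ∀ (s t : ℝ≥0) (f : Config n → ℝ), (∃ B, ∀ x, |f x| ≤ B) →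
    P[fun ω => f (η (s + t) ω) | past η s] =ᵐ[P] fun ω => semigroup p q t f (η s ω)

/-- The packed initial configuration: particles at the sites `1, 2, …, n`. -/
def packed (n : ℕ) : Config n :=
  ⟨fun i => ((i : ℕ) : ℤ) + 1, fun _ _ h => by
    have : (_ : ℕ) < _ := h
    simpa using this⟩

end ASEP

open scoped ENNReal

/-! Only the two extreme particles matter, since all others lie between them. For these, the product
of a fixed-time exponential tail and a maximal inequality over unit time windows is enough.

Tails come from reversing the point of view. Under the measure with density exp(α x₁ + β xₙ), α ≥ 0
≥ β, the total jump operator multiplies mass by at most `growth` (`tsum_weight_mul_jumpOp_le`): a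
free bond contributes at least as much as a blocked one, so exclusion only helps. This infinite
measure cannot see one starting point, but attractiveness can: the probability that the first
particle is far left is larger from every configuration below the packed one. Averaging over all of
these gives `semigroup_le_of_weight`, and in gap coordinates the sums are geometric. With (α, β) =
(2ε, -ε), or (ε, -2ε) for the last particle, the drift cancels and a deviation D at time t has
probability at most about exp(5ε²t - εD + O(n)) (`semigroup_first_le`, `semigroup_last_le`).

For all times at once, an extreme particle that is too far out at some time in a unit window is,
with probability at least 1/2, still nearly as far out at its end (`half_le_semigroup`,
`measure_window_le`). Taking ε of order M/√N and D of order √N·M, where M is the maximum in the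
statement, makes each window's failure probability O(N⁻²), and there are O(N) windows. -/

namespace ASEP

/-! ### Uniformization of the semigroup -/

/-- The total jump operator `A f x = ∑ i, p f (x^{i,+}) + q f (x^{i,-})`; for `p + q = 1` the
generator is `A - n`. -/
def jumpOp (p q : ℝ) (n : ℕ) : Module.End ℝ (Config n → ℝ) where
  toFun f x := ∑ i : Fin n, (p * f (moveRight i x) + q * f (moveLeft i x))
  map_add' f g := by
    ext x
    simp only [Pi.add_apply, ← Finset.sum_add_distrib]
    exact Finset.sum_congr rfl fun i _ => by ring
  map_smul' c f := by
    ext x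
    simp only [Pi.smul_apply, smul_eq_mul, RingHom.id_apply, Finset.mul_sum]
    exact Finset.sum_congr rfl fun i _ => by ring

theorem jumpOp_apply (p q : ℝ) {n : ℕ} (f : Config n → ℝ) (x : Config n) :
    jumpOp p q n f x = ∑ i : Fin n, (p * f (moveRight i x) + q * f (moveLeft i x)) := rfl

theorem jumpOp_pow_succ (p q : ℝ) {n : ℕ} (k : ℕ) (f : Config n → ℝ) :
    (jumpOp p q n ^ (k + 1)) f = jumpOp p q n ((jumpOp p q n ^ k) f) := by
  rw [pow_succ', Module.End.mul_apply]

theorem generator_iterate_eq {p q : ℝ} (hpq : p + q = 1) {n : ℕ} (k : ℕ) (f : Config n → ℝ) :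
    (generator p q)^[k] f = ((jumpOp p q n + (-(n : ℝ)) • 1) ^ k) f := by
  induction k with
  | zero => rfl
  | succ k ih =>
    rw [Function.iterate_succ_apply', ih, pow_succ', Module.End.mul_apply]
    generalize ((jumpOp p q n + (-(n : ℝ)) • 1) ^ k) f = g
    ext x
    simp only [generator, LinearMap.add_apply, LinearMap.smul_apply, Module.End.one_apply,
      Pi.add_apply, Pi.smul_apply, smul_eq_mul, jumpOp_apply]
    have : (n : ℝ) = ∑ _i : Fin n, (1 : ℝ) := by simp
    rw [this, ← Finset.sum_neg_distrib, Finset.sum_mul, ← Finset.sum_add_distrib]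
    refine Finset.sum_congr rfl fun i _ => ?_
    linear_combination (-g x) * hpq

section Positive

variable {p q : ℝ} {n : ℕ}

theorem jumpOp_pow_nonneg (hp : 0 ≤ p) (hq : 0 ≤ q) {f : Config n → ℝ} (hf : ∀ x, 0 ≤ f x)
    (k : ℕ) (x : Config n) : 0 ≤ (jumpOp p q n ^ k) f x := by
  induction k generalizing x with
  | zero => exact hf x
  | succ k ih =>
    rw [jumpOp_pow_succ, jumpOp_apply]
    exact Finset.sum_nonneg fun i _ =>
      add_nonneg (mul_nonneg hp (ih _)) (mul_nonneg hq (ih _))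

theorem abs_jumpOp_pow_le (hp : 0 ≤ p) (hq : 0 ≤ q) (hpq : p + q = 1) {f : Config n → ℝ} {B : ℝ}
    (hf : ∀ x, |f x| ≤ B) (k : ℕ) (x : Config n) :
    |(jumpOp p q n ^ k) f x| ≤ (n : ℝ) ^ k * B := by
  induction k generalizing x with
  | zero => simpa using hf x
  | succ k ih =>
    rw [jumpOp_pow_succ, jumpOp_apply]
    refine (Finset.abs_sum_le_sum_abs _ _).trans ?_
    have : ∀ i ∈ (Finset.univ : Finset (Fin n)),
        |p * (jumpOp p q n ^ k) f (moveRight i x) + q * (jumpOp p q n ^ k) f (moveLeft i x)| ≤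
          (n : ℝ) ^ k * B := fun i _ => by
      refine (abs_add_le _ _).trans ?_
      rw [abs_mul, abs_mul, abs_of_nonneg hp, abs_of_nonneg hq]
      calc _ ≤ p * ((n : ℝ) ^ k * B) + q * ((n : ℝ) ^ k * B) := by gcongr <;> exact ih _
        _ = _ := by rw [← add_mul, hpq, one_mul]
    refine (Finset.sum_le_sum this).trans (le_of_eq ?_)
    simp only [Finset.sum_const, Finset.card_univ, Fintype.card_fin, nsmul_eq_mul]
    ring

theorem summable_norm_jumpOp (hp : 0 ≤ p) (hq : 0 ≤ q) (hpq : p + q = 1) {f : Config n → ℝ}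
    {B : ℝ} (hf : ∀ x, |f x| ≤ B) (t : ℝ) (x : Config n) :
    Summable fun k : ℕ => ‖t ^ k / (Nat.factorial k : ℝ) * (jumpOp p q n ^ k) f x‖ := by
  refine Summable.of_nonneg_of_le (fun _ => norm_nonneg _) (fun k => ?_)
    ((Real.summable_pow_div_factorial (|t| * n)).mul_right B)
  rw [Real.norm_eq_abs, abs_mul, abs_div, abs_pow, Nat.abs_cast, mul_pow]
  calc _ ≤ |t| ^ k / (Nat.factorial k : ℝ) * ((n : ℝ) ^ k * B) := by
        gcongr
        exact abs_jumpOp_pow_le hp hq hpq hf k x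
    _ = _ := by ring

theorem hasSum_pow_div_factorial (x : ℝ) :
    HasSum (fun k : ℕ => x ^ k / (Nat.factorial k : ℝ)) (Real.exp x) := by
  rw [Real.exp_eq_exp_ℝ]
  exact NormedSpace.expSeries_div_hasSum_exp x

/-- Uniformization of the semigroup. -/
theorem semigroup_eq_exp_mul_tsum (hp : 0 ≤ p) (hq : 0 ≤ q) (hpq : p + q = 1) {f : Config n → ℝ}
    {B : ℝ} (hf : ∀ x, |f x| ≤ B) (t : ℝ) (x : Config n) :
    semigroup p q t f x =
      Real.exp (-(n * t)) * ∑' k : ℕ, t ^ k / (Nat.factorial k : ℝ) * (jumpOp p q n ^ k) f x := by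
  have h1 := summable_norm_jumpOp hp hq hpq hf t x
  have h2 : Summable fun k : ℕ => ‖(-(n * t)) ^ k / (Nat.factorial k : ℝ)‖ :=
    (Real.summable_pow_div_factorial (-(n * t))).norm
  rw [← (hasSum_pow_div_factorial (-(n * t))).tsum_eq, mul_comm,
    tsum_mul_tsum_eq_tsum_sum_antidiagonal_of_summable_norm h1 h2, semigroup]
  congr 1
  ext k
  have hc : Commute (jumpOp p q n) ((-(n : ℝ)) • (1 : Module.End ℝ (Config n → ℝ))) :=
    (Commute.one_right _).smul_right _
  rw [generator_iterate_eq hpq, hc.add_pow', LinearMap.sum_apply, Finset.sum_apply,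
    Finset.mul_sum]
  refine Finset.sum_congr rfl fun m hm => ?_
  obtain ⟨i, j⟩ := m
  have hij : i + j = k := by simpa using hm
  subst hij
  have h3 : ((i + j).choose i : ℝ) = (i + j).factorial / (i.factorial * j.factorial) := by
    rw [Nat.cast_add_choose]
  simp only [← Nat.cast_smul_eq_nsmul ℝ, smul_pow, one_pow, mul_smul_comm, mul_one,
    LinearMap.smul_apply, Pi.smul_apply, smul_eq_mul]
  rw [h3, ← neg_mul, mul_pow]
  have := (Nat.factorial_pos (i + j)).ne'
  field_simp
  ring

/-- Reduces continuous time to iterates of a positive operator: geometric growth Λ^k sums to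
exp(Λt), against the normalization exp(-nt). -/
theorem semigroup_le_of_jumpOp_pow_le (hp : 0 ≤ p) (hq : 0 ≤ q) (hpq : p + q = 1)
    {f : Config n → ℝ} {B : ℝ} (hf : ∀ x, |f x| ≤ B) {t : ℝ} (ht : 0 ≤ t) (x : Config n)
    {Λ R : ℝ} (h : ∀ k, (jumpOp p q n ^ k) f x ≤ Λ ^ k * R) :
    semigroup p q t f x ≤ Real.exp ((Λ - n) * t) * R := by
  rw [semigroup_eq_exp_mul_tsum hp hq hpq hf,
    show (Λ - n) * t = -(n * t) + t * Λ by ring, Real.exp_add, mul_assoc]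
  refine mul_le_mul_of_nonneg_left ?_ (Real.exp_pos _).le
  refine hasSum_le (fun k => ?_) (summable_norm_jumpOp hp hq hpq hf t x).of_norm.hasSum
    ((hasSum_pow_div_factorial (t * Λ)).mul_right R)
  rw [mul_pow]
  calc _ ≤ t ^ k / (Nat.factorial k : ℝ) * (Λ ^ k * R) := by
        gcongr
        exact h k
    _ = _ := by ring

theorem hasSum_pow_div_factorial_mul_nat (x : ℝ) :
    HasSum (fun k : ℕ => x ^ k / (Nat.factorial k : ℝ) * k) (x * Real.exp x) := by
  rw [← hasSum_nat_add_iff' 1]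
  simp only [Finset.range_one, Finset.sum_singleton, Nat.cast_zero, mul_zero, sub_zero]
  refine ((hasSum_pow_div_factorial x).mul_left x).congr_fun fun k => ?_
  have := (Nat.factorial_pos k).ne'
  rw [Nat.factorial_succ]
  push_cast
  field_simp
  ring

/-- An integer observable that grows by at most one at each jump is unlikely to grow by `2 n` within
a unit of time. -/
theorem half_le_semigroup (hp : 0 ≤ p) (hq : 0 ≤ q) (hpq : p + q = 1) (hn : 0 < n)
    {h : Config n → ℤ} (hR : ∀ i x, h (moveRight i x) ≤ h x + 1)
    (hL : ∀ i x, h (moveLeft i x) ≤ h x + 1) {A : ℤ} {x : Config n} (hx : h x ≤ A - 2 * n)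
    {t : ℝ} (ht : 0 ≤ t) (ht1 : t ≤ 1) :
    1 / 2 ≤ semigroup p q t (fun y => if h y ≤ A then 1 else 0) x := by
  set f : Config n → ℝ := fun y => if h y ≤ A then 1 else 0 with hfdef
  have hf0 : ∀ y, 0 ≤ f y := fun y => by simp only [hfdef]; split_ifs <;> norm_num
  have hf1 : ∀ y, |f y| ≤ 1 := fun y => by simp only [hfdef]; split_ifs <;> norm_num
  -- After k jumps the observable has grown by at most k, so the indicator is still 1 along every
  -- path.
  have key : ∀ (k : ℕ) (y : Config n), h y + k ≤ A → (jumpOp p q n ^ k) f y = (n : ℝ) ^ k := by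
    intro k
    induction k with
    | zero => intro y hy; simp [hfdef] at hy ⊢; exact hy
    | succ k ih =>
      intro y hy
      push_cast at hy
      rw [jumpOp_pow_succ, jumpOp_apply]
      have : ∀ i ∈ (Finset.univ : Finset (Fin n)), p * (jumpOp p q n ^ k) f (moveRight i y) +
          q * (jumpOp p q n ^ k) f (moveLeft i y) = (n : ℝ) ^ k := fun i _ => by
        rw [ih _ (by linarith [hR i y]), ih _ (by linarith [hL i y]), ← add_mul, hpq, one_mul]
      rw [Finset.sum_congr rfl this]
      simp [pow_succ, mul_comm]
  have hn' : (0 : ℝ) < n := by exact_mod_cast hn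
  -- Markov's inequality for the Poisson number of jumps, in the form 1{k ≤ 2n} ≥ 1 - k/(2n). Its
  -- mean nt turns the bound into 1 - t/2.
  have lower : ∀ k : ℕ, (n : ℝ) ^ k * (1 - k / (2 * n)) ≤ (jumpOp p q n ^ k) f x := by
    intro k
    by_cases hk : k ≤ 2 * n
    · rw [key k x (by have : (k : ℤ) ≤ 2 * n := by exact_mod_cast hk
                      linarith)]
      have : (0 : ℝ) ≤ k / (2 * n) := by positivity
      nlinarith [pow_pos hn' k]
    · refine le_trans ?_ (jumpOp_pow_nonneg hp hq hf0 k x)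
      refine mul_nonpos_of_nonneg_of_nonpos (by positivity) ?_
      rw [sub_nonpos, le_div_iff₀ (by positivity), one_mul]
      exact_mod_cast (not_le.mp hk).le
  rw [semigroup_eq_exp_mul_tsum hp hq hpq hf1]
  have hs := ((hasSum_pow_div_factorial (n * t)).sub
    ((hasSum_pow_div_factorial_mul_nat (n * t)).mul_right (1 / (2 * n : ℝ))))
  have hle := hasSum_le (fun k => ?_) hs
    (summable_norm_jumpOp hp hq hpq hf1 t x).of_norm.hasSum
  · calc (1 : ℝ) / 2 ≤ 1 - t / 2 := by linarith
      _ = Real.exp (-(n * t)) *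
          (Real.exp (n * t) - n * t * Real.exp (n * t) * (1 / (2 * n))) := by
        rw [mul_sub, ← mul_assoc, ← mul_assoc, mul_comm _ (n * t : ℝ), mul_assoc (n * t : ℝ),
          ← Real.exp_add]
        simp
        field_simp
      _ ≤ _ := mul_le_mul_of_nonneg_left hle (Real.exp_pos _).le
  · calc _ = t ^ k / (Nat.factorial k : ℝ) * ((n : ℝ) ^ k * (1 - k / (2 * n))) := by
          rw [mul_pow]; ring
      _ ≤ _ := mul_le_mul_of_nonneg_left (lower k) (by positivity)

end Positive

/-! ### Attractiveness -/

section Monotone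

variable {n : ℕ}

/-- This is the coupling in which particles of equal index attempt the same jump. Order could break
only if x i = y i and y alone is blocked, by some y k = y i + 1; but then x i < x k ≤ y k forces x
to be blocked too. -/
theorem monotone_moveRight (i : Fin n) : Monotone (moveRight i : Config n → Config n) := by
  intro x y hxy j
  have hj : x.1 j ≤ y.1 j := hxy j
  have hi : x.1 i ≤ y.1 i := hxy i
  show (moveRight i x).1 j ≤ (moveRight i y).1 j
  unfold moveRight
  split_ifs with h1 h2 h2
  · rcases eq_or_ne j i with rfl | hji
    · simpa using hj
    · simpa [hji] using hj
  · rcases eq_or_ne j i with rfl | hji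
    · push Not at h2
      obtain ⟨k, hk⟩ := h2
      simp only [Function.update_self]
      by_contra hlt
      have hxk : x.1 k ≤ y.1 k := hxy k
      have hjk : j < k := y.2.lt_iff_lt.mp (by omega)
      have := x.2 hjk
      exact h1 k (by omega)
    · simpa [hji] using hj
  · rcases eq_or_ne j i with rfl | hji
    · simp only [Function.update_self]; omega
    · simpa [hji] using hj
  · exact hj

theorem monotone_moveLeft (i : Fin n) : Monotone (moveLeft i : Config n → Config n) := by
  intro x y hxy j
  have hj : x.1 j ≤ y.1 j := hxy j
  have hi : x.1 i ≤ y.1 i := hxy i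
  show (moveLeft i x).1 j ≤ (moveLeft i y).1 j
  unfold moveLeft
  split_ifs with h1 h2 h2
  · rcases eq_or_ne j i with rfl | hji
    · simpa using hj
    · simpa [hji] using hj
  · rcases eq_or_ne j i with rfl | hji
    · simp only [Function.update_self]; omega
    · simpa [hji] using hj
  · rcases eq_or_ne j i with rfl | hji
    · push Not at h1
      obtain ⟨k, hk⟩ := h1
      simp only [Function.update_self]
      by_contra hlt
      have hxk : x.1 k ≤ y.1 k := hxy k
      have hjk : k < j := x.2.lt_iff_lt.mp (by omega)
      have := y.2 hjk
      exact h2 k (by omega)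
    · simpa [hji] using hj
  · exact hj

theorem monotone_jumpOp_pow {p q : ℝ} (hp : 0 ≤ p) (hq : 0 ≤ q) {f : Config n → ℝ}
    (hf : Monotone f) (k : ℕ) : Monotone ((jumpOp p q n ^ k) f) := by
  induction k with
  | zero => exact hf
  | succ k ih =>
    intro x y hxy
    rw [jumpOp_pow_succ, jumpOp_apply, jumpOp_apply]
    gcongr with i
    · exact ih (monotone_moveRight i hxy)
    · exact ih (monotone_moveLeft i hxy)

theorem antitone_jumpOp_pow {p q : ℝ} (hp : 0 ≤ p) (hq : 0 ≤ q) {f : Config n → ℝ}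
    (hf : Antitone f) (k : ℕ) : Antitone ((jumpOp p q n ^ k) f) := by
  have h : Monotone ((jumpOp p q n ^ k) (-f)) := monotone_jumpOp_pow hp hq hf.neg k
  rw [map_neg] at h
  intro x y hxy
  exact neg_le_neg_iff.mp (h hxy)

theorem moveRight_apply_le (i j : Fin n) (x : Config n) : (moveRight i x).1 j ≤ x.1 j + 1 := by
  unfold moveRight
  split_ifs
  · rcases eq_or_ne j i with rfl | hji
    · simp
    · simp [hji]
  · simp

theorem le_moveRight (i : Fin n) (x : Config n) (j : Fin n) : x.1 j ≤ (moveRight i x).1 j := by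
  unfold moveRight
  split_ifs
  · rcases eq_or_ne j i with rfl | hji
    · simp
    · simp [hji]
  · simp

theorem moveLeft_le (i : Fin n) (x : Config n) (j : Fin n) : (moveLeft i x).1 j ≤ x.1 j := by
  unfold moveLeft
  split_ifs
  · rcases eq_or_ne j i with rfl | hji
    · simp
    · simp [hji]
  · simp

theorem le_moveLeft_apply_add_one (i j : Fin n) (x : Config n) :
    x.1 j ≤ (moveLeft i x).1 j + 1 := by
  unfold moveLeft
  split_ifs
  · rcases eq_or_ne j i with rfl | hji
    · simp
    · simp [hji]
  · simp

end Monotone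

/-! ### Exponential weights as subinvariant measures -/

section

/-- Needed to push measures forward: w is reached either by a suppressed jump from w itself or by
undoing a genuine jump, and the state of the neighbouring site decides which is possible. -/
theorem eq_or_eq_of_moveRight_eq {n : ℕ} {i : Fin n} {y w : Config n} (h : moveRight i y = w) :
    (y = w ∧ ∃ j, w.1 j = w.1 i + 1) ∨ (y = moveLeft i w ∧ ∀ j, w.1 j ≠ w.1 i - 1) := by
  by_cases hy : ∀ j, y.1 j ≠ y.1 i + 1
  · right
    rw [moveRight, dif_pos hy] at h
    have hw : w.1 = Function.update y.1 i (y.1 i + 1) := by rw [← h]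
    have hfree : ∀ j, w.1 j ≠ w.1 i - 1 := by
      intro j
      rw [hw, Function.update_self]
      rcases eq_or_ne j i with rfl | hji
      · simp
      · rw [Function.update_of_ne hji]
        have := y.2.injective.ne hji
        omega
    refine ⟨?_, hfree⟩
    rw [moveLeft, dif_pos hfree]
    ext j
    simp only [hw]
    rcases eq_or_ne j i with rfl | hji
    · simp
    · simp [hji]
  · left
    rw [moveRight, dif_neg hy] at h
    subst h
    push Not at hy
    exact ⟨rfl, hy⟩

theorem eq_or_eq_of_moveLeft_eq {n : ℕ} {i : Fin n} {y w : Config n} (h : moveLeft i y = w) :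
    (y = w ∧ ∃ j, w.1 j = w.1 i - 1) ∨ (y = moveRight i w ∧ ∀ j, w.1 j ≠ w.1 i + 1) := by
  by_cases hy : ∀ j, y.1 j ≠ y.1 i - 1
  · right
    rw [moveLeft, dif_pos hy] at h
    have hw : w.1 = Function.update y.1 i (y.1 i - 1) := by rw [← h]
    have hfree : ∀ j, w.1 j ≠ w.1 i + 1 := by
      intro j
      rw [hw, Function.update_self]
      rcases eq_or_ne j i with rfl | hji
      · simp
      · rw [Function.update_of_ne hji]
        have := y.2.injective.ne hji
        omega
    refine ⟨?_, hfree⟩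
    rw [moveRight, dif_pos hfree]
    ext j
    simp only [hw]
    rcases eq_or_ne j i with rfl | hji
    · simp
    · simp [hji]
  · left
    rw [moveLeft, dif_neg hy] at h
    subst h
    push Not at hy
    exact ⟨rfl, hy⟩

variable {m : ℕ}

/-- The weight `exp (α x₁ + β xₙ)` of a configuration. -/
noncomputable def weight (α β : ℝ) (x : Config (m + 1)) : ℝ :=
  Real.exp (α * x.1 0 + β * x.1 (Fin.last m))

/-- The exponent by which a jump of the `i`-th particle changes the weight. -/
noncomputable def tilt (m : ℕ) (α β : ℝ) (i : Fin (m + 1)) : ℝ :=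
  (if i = 0 then α else 0) + (if i = Fin.last m then β else 0)

theorem weight_moveLeft (α β : ℝ) {i : Fin (m + 1)} {w : Config (m + 1)}
    (h : ∀ j, w.1 j ≠ w.1 i - 1) :
    weight α β (moveLeft i w) = weight α β w * Real.exp (-tilt m α β i) := by
  rw [weight, weight, ← Real.exp_add, moveLeft, dif_pos h, tilt]
  congr 1
  have e : ∀ j, Function.update w.1 i (w.1 i - 1) j = w.1 j - (if i = j then 1 else 0) := by
    intro j
    rcases eq_or_ne i j with rfl | hij
    · simp
    · simp [hij, hij.symm]
  simp only [e]
  split_ifs <;> push_cast <;> ring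

theorem weight_moveRight (α β : ℝ) {i : Fin (m + 1)} {w : Config (m + 1)}
    (h : ∀ j, w.1 j ≠ w.1 i + 1) :
    weight α β (moveRight i w) = weight α β w * Real.exp (tilt m α β i) := by
  rw [weight, weight, ← Real.exp_add, moveRight, dif_pos h, tilt]
  congr 1
  have e : ∀ j, Function.update w.1 i (w.1 i + 1) j = w.1 j + (if i = j then 1 else 0) := by
    intro j
    rcases eq_or_ne i j with rfl | hij
    · simp
    · simp [hij, hij.symm]
  simp only [e]
  split_ifs <;> push_cast <;> ring

open Classical in
theorem tsum_weight_moveRight_le (α β : ℝ) (i : Fin (m + 1)) (w : Config (m + 1)) :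
    ∑' y : Config (m + 1),
        (if moveRight i y = w then ENNReal.ofReal (weight α β y) else 0) ≤
      ENNReal.ofReal (weight α β w * ((if ∀ j, w.1 j ≠ w.1 i + 1 then 0 else 1) +
        (if ∀ j, w.1 j ≠ w.1 i - 1 then Real.exp (-tilt m α β i) else 0))) := by
  have hw : 0 ≤ weight α β w := (Real.exp_pos _).le
  calc _ ≤ ∑' y : Config (m + 1),
        ((if y = w then ENNReal.ofReal
            (weight α β w * (if ∀ j, w.1 j ≠ w.1 i + 1 then 0 else 1)) else 0) +
          (if y = moveLeft i w then ENNReal.ofReal (weight α β w *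
            (if ∀ j, w.1 j ≠ w.1 i - 1 then Real.exp (-tilt m α β i) else 0)) else 0)) := by
        refine ENNReal.tsum_le_tsum fun y => ?_
        by_cases h : moveRight i y = w
        · rw [if_pos h]
          rcases eq_or_eq_of_moveRight_eq h with ⟨h1, h2⟩ | ⟨h1, h2⟩
          · refine le_trans ?_ le_self_add
            have h3 : ¬ ∀ j, w.1 j ≠ w.1 i + 1 := by push Not; exact h2
            rw [if_pos h1, if_neg h3, mul_one, h1]
          · refine le_trans ?_ le_add_self
            rw [if_pos h1, if_pos h2, h1, weight_moveLeft α β h2]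
        · rw [if_neg h]
          exact zero_le
    _ = _ := by
        rw [ENNReal.tsum_add, tsum_ite_eq, tsum_ite_eq, mul_add, ENNReal.ofReal_add]
        · split_ifs <;> positivity
        · split_ifs <;> positivity

open Classical in
theorem tsum_weight_moveLeft_le (α β : ℝ) (i : Fin (m + 1)) (w : Config (m + 1)) :
    ∑' y : Config (m + 1),
        (if moveLeft i y = w then ENNReal.ofReal (weight α β y) else 0) ≤
      ENNReal.ofReal (weight α β w * ((if ∀ j, w.1 j ≠ w.1 i - 1 then 0 else 1) +
        (if ∀ j, w.1 j ≠ w.1 i + 1 then Real.exp (tilt m α β i) else 0))) := by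
  have hw : 0 ≤ weight α β w := (Real.exp_pos _).le
  calc _ ≤ ∑' y : Config (m + 1),
        ((if y = w then ENNReal.ofReal
            (weight α β w * (if ∀ j, w.1 j ≠ w.1 i - 1 then 0 else 1)) else 0) +
          (if y = moveRight i w then ENNReal.ofReal (weight α β w *
            (if ∀ j, w.1 j ≠ w.1 i + 1 then Real.exp (tilt m α β i) else 0)) else 0)) := by
        refine ENNReal.tsum_le_tsum fun y => ?_
        by_cases h : moveLeft i y = w
        · rw [if_pos h]
          rcases eq_or_eq_of_moveLeft_eq h with ⟨h1, h2⟩ | ⟨h1, h2⟩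
          · refine le_trans ?_ le_self_add
            have h3 : ¬ ∀ j, w.1 j ≠ w.1 i - 1 := by push Not; exact h2
            rw [if_pos h1, if_neg h3, mul_one, h1]
          · refine le_trans ?_ le_add_self
            rw [if_pos h1, if_pos h2, h1, weight_moveRight α β h2]
        · rw [if_neg h]
          exact zero_le
    _ = _ := by
        rw [ENNReal.tsum_add, tsum_ite_eq, tsum_ite_eq, mul_add, ENNReal.ofReal_add]
        · split_ifs <;> positivity
        · split_ifs <;> positivity

/-- Both sides say that the bond between two consecutive particles has a gap. This lets the rates be
summed bond by bond. -/
theorem free_succ_iff (w : Config (m + 1)) (j : Fin m) :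
    (∀ k, w.1 k ≠ w.1 j.succ - 1) ↔ ∀ k, w.1 k ≠ w.1 j.castSucc + 1 := by
  constructor
  · intro h k hk
    have h1 : j.castSucc < k := w.2.lt_iff_lt.mp (by omega)
    have h2 : w.1 j.succ ≤ w.1 k := w.2.monotone (Fin.castSucc_lt_iff_succ_le.mp h1)
    have h3 := w.2 (Fin.castSucc_lt_succ (i := j))
    exact h j.castSucc (by omega)
  · intro h k hk
    have h1 : k < j.succ := w.2.lt_iff_lt.mp (by omega)
    have h2 : w.1 k ≤ w.1 j.castSucc := w.2.monotone (Fin.le_castSucc_iff.mpr h1)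
    have h3 := w.2 (Fin.castSucc_lt_succ (i := j))
    exact h j.succ (by omega)

/-- The growth rate of the weight, shifted by the number of particles. -/
noncomputable def growth (p q : ℝ) (m : ℕ) (α β : ℝ) : ℝ :=
  (m + 1) + (p * (Real.exp (-α) - 1) + q * (Real.exp α - 1)) +
    (p * (Real.exp (-β) - 1) + q * (Real.exp β - 1))

section Growth

variable {p q α β : ℝ} (hp : 0 ≤ p) (hq : 0 ≤ q) (hpq : p + q = 1) (hα : 0 ≤ α) (hβ : β ≤ 0)

-- Interior particles contribute p + q = 1. For a single particle both tilts act on the same index,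
-- and the resulting cross terms, such as (exp(-α) - 1)(exp(-β) - 1), are nonpositive because α and
-- β have opposite signs.
include hp hq hpq hα hβ in
theorem sum_exp_tilt_le :
    ∑ i : Fin (m + 1), (p * Real.exp (-tilt m α β i) + q * Real.exp (tilt m α β i)) ≤
      growth p q m α β := by
  have key : ∀ i ∈ (Finset.univ : Finset (Fin (m + 1))),
      p * Real.exp (-tilt m α β i) + q * Real.exp (tilt m α β i) ≤
      1 + (if i = 0 then p * (Real.exp (-α) - 1) + q * (Real.exp α - 1) else 0) +
      (if i = Fin.last m then p * (Real.exp (-β) - 1) + q * (Real.exp β - 1) else 0) := by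
    intro i _
    have h1 : 1 ≤ Real.exp α := Real.one_le_exp hα
    have h2 : Real.exp β ≤ 1 := Real.exp_le_one_iff.mpr hβ
    have h3 : Real.exp (-α) ≤ 1 := Real.exp_le_one_iff.mpr (by linarith)
    have h4 : 1 ≤ Real.exp (-β) := Real.one_le_exp (by linarith)
    unfold tilt
    split_ifs
    · rw [neg_add, Real.exp_add, Real.exp_add]
      have h5 := mul_nonneg hp (mul_nonneg (sub_nonneg.2 h3) (sub_nonneg.2 h4))
      have h6 := mul_nonneg hq (mul_nonneg (sub_nonneg.2 h1) (sub_nonneg.2 h2))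
      nlinarith
    · simp only [add_zero]; linarith
    · simp only [zero_add, add_zero]; linarith
    · simp [hpq]
  refine (Finset.sum_le_sum key).trans (le_of_eq ?_)
  simp only [Finset.sum_add_distrib, Finset.sum_ite_eq', Finset.mem_univ, if_true, growth]
  simp

-- Regroup by bonds. A blocked bond contributes q + p = 1; a free one contributes p·exp(-tilt) of
-- its right particle plus q·exp(tilt) of its left particle, which is at least 1 since those tilts
-- are respectively ≤ 0 and ≥ 0. Hence the worst case has every bond free.
open Classical in
include hp hq hpq hα hβ in
theorem sum_rates_le_growth (w : Config (m + 1)) :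
    ∑ i : Fin (m + 1),
      (p * ((if ∀ j, w.1 j ≠ w.1 i + 1 then 0 else 1) +
          (if ∀ j, w.1 j ≠ w.1 i - 1 then Real.exp (-tilt m α β i) else 0)) +
        q * ((if ∀ j, w.1 j ≠ w.1 i - 1 then 0 else 1) +
          (if ∀ j, w.1 j ≠ w.1 i + 1 then Real.exp (tilt m α β i) else 0))) ≤
      growth p q m α β := by
  refine le_trans (le_trans (b := ∑ i : Fin (m + 1),
        (if ∀ j, w.1 j ≠ w.1 i - 1 then p * Real.exp (-tilt m α β i) else q) +
      ∑ i : Fin (m + 1), (if ∀ j, w.1 j ≠ w.1 i + 1 then q * Real.exp (tilt m α β i) else p))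
    (le_of_eq ?_) ?_) (sum_exp_tilt_le (m := m) hp hq hpq hα hβ)
  · rw [← Finset.sum_add_distrib]
    refine Finset.sum_congr rfl fun i _ => ?_
    split_ifs <;> ring
  · rw [Finset.sum_add_distrib, Fin.sum_univ_succ, Fin.sum_univ_castSucc (n := m),
      Fin.sum_univ_succ (f := fun i => p * Real.exp (-tilt m α β i)),
      Fin.sum_univ_castSucc (f := fun i => q * Real.exp (tilt m α β i))]
    have h0 : ∀ j, w.1 j ≠ w.1 0 - 1 := fun j h => by
      have := w.2.monotone (Fin.zero_le j)
      omega
    have hl : ∀ j, w.1 j ≠ w.1 (Fin.last m) + 1 := fun j h => by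
      have := w.2.monotone (Fin.le_last j)
      omega
    rw [if_pos h0, if_pos hl]
    have key : ∀ j ∈ (Finset.univ : Finset (Fin m)),
        (if ∀ k, w.1 k ≠ w.1 j.succ - 1 then p * Real.exp (-tilt m α β j.succ) else q) +
        (if ∀ k, w.1 k ≠ w.1 j.castSucc + 1 then q * Real.exp (tilt m α β j.castSucc) else p) ≤
        p * Real.exp (-tilt m α β j.succ) + q * Real.exp (tilt m α β j.castSucc) := by
      intro j _
      simp only [free_succ_iff]
      split_ifs with h
      · exact le_rfl
      · have h1 : 1 ≤ Real.exp (-tilt m α β j.succ) := Real.one_le_exp (by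
          simp only [tilt, Fin.succ_ne_zero, if_false]
          split_ifs <;> linarith)
        have h2 : 1 ≤ Real.exp (tilt m α β j.castSucc) := Real.one_le_exp (by
          simp only [tilt, (Fin.castSucc_lt_last j).ne, if_false]
          split_ifs <;> linarith)
        nlinarith
    have := Finset.sum_le_sum key
    rw [Finset.sum_add_distrib, Finset.sum_add_distrib] at this
    linarith

include hp hq hpq hα hβ in
/-- The weight is a subinvariant measure for the jump operator. -/
theorem tsum_weight_mul_jumpOp_le {f : Config (m + 1) → ℝ} (hf : ∀ x, 0 ≤ f x) :
    ∑' y, ENNReal.ofReal (weight α β y * jumpOp p q (m + 1) f y) ≤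
      ENNReal.ofReal (growth p q m α β) * ∑' y, ENNReal.ofReal (weight α β y * f y) := by
  classical
  have hw : ∀ y : Config (m + 1), 0 ≤ weight α β y := fun y => (Real.exp_pos _).le
  -- Spreading each jump over its target w allows Tonelli to turn the action on f into the action on
  -- the measure.
  have expand : ∀ y : Config (m + 1), ENNReal.ofReal (weight α β y * jumpOp p q (m + 1) f y) =
      ∑' w, ∑ i : Fin (m + 1), ENNReal.ofReal (f w) *
        (ENNReal.ofReal p * (if moveRight i y = w then ENNReal.ofReal (weight α β y) else 0) +
         ENNReal.ofReal q * (if moveLeft i y = w then ENNReal.ofReal (weight α β y) else 0)) := by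
    intro y
    rw [Summable.tsum_finsetSum fun _ _ => ENNReal.summable, jumpOp_apply, Finset.mul_sum,
      ENNReal.ofReal_sum_of_nonneg fun i _ => mul_nonneg (hw y)
        (add_nonneg (mul_nonneg hp (hf _)) (mul_nonneg hq (hf _)))]
    refine Finset.sum_congr rfl fun i _ => ?_
    have e : ∀ w : Config (m + 1), ENNReal.ofReal (f w) *
        (ENNReal.ofReal p * (if moveRight i y = w then ENNReal.ofReal (weight α β y) else 0) +
         ENNReal.ofReal q * (if moveLeft i y = w then ENNReal.ofReal (weight α β y) else 0)) =
        (if w = moveRight i y then ENNReal.ofReal (f w * p * weight α β y) else 0) +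
        (if w = moveLeft i y then ENNReal.ofReal (f w * q * weight α β y) else 0) := by
      intro w
      rw [mul_add, ENNReal.ofReal_mul (mul_nonneg (hf w) hp), ENNReal.ofReal_mul (hf w),
        ENNReal.ofReal_mul (mul_nonneg (hf w) hq), ENNReal.ofReal_mul (hf w)]
      simp only [eq_comm (b := w), mul_ite, mul_zero, mul_assoc]
    simp only [e]
    rw [ENNReal.tsum_add]
    have h1 := tsum_ite_eq (moveRight i y) fun w => ENNReal.ofReal (f w * p * weight α β y)
    have h2 := tsum_ite_eq (moveLeft i y) fun w => ENNReal.ofReal (f w * q * weight α β y)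
    rw [h1, h2, ← ENNReal.ofReal_add (mul_nonneg (mul_nonneg (hf _) hp) (hw y))
      (mul_nonneg (mul_nonneg (hf _) hq) (hw y))]
    congr 1
    ring
  simp only [expand]
  rw [ENNReal.tsum_comm, ← ENNReal.tsum_mul_left]
  refine ENNReal.tsum_le_tsum fun w => ?_
  rw [Summable.tsum_finsetSum fun _ _ => ENNReal.summable]
  have hR : ∀ i : Fin (m + 1), (0 : ℝ) ≤ (if ∀ j, w.1 j ≠ w.1 i + 1 then 0 else 1) +
      (if ∀ j, w.1 j ≠ w.1 i - 1 then Real.exp (-tilt m α β i) else 0) := fun i => by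
    split_ifs <;> positivity
  have hL : ∀ i : Fin (m + 1), (0 : ℝ) ≤ (if ∀ j, w.1 j ≠ w.1 i - 1 then 0 else 1) +
      (if ∀ j, w.1 j ≠ w.1 i + 1 then Real.exp (tilt m α β i) else 0) := fun i => by
    split_ifs <;> positivity
  have step : ∀ i ∈ (Finset.univ : Finset (Fin (m + 1))), ∑' y, ENNReal.ofReal (f w) *
        (ENNReal.ofReal p * (if moveRight i y = w then ENNReal.ofReal (weight α β y) else 0) +
         ENNReal.ofReal q * (if moveLeft i y = w then ENNReal.ofReal (weight α β y) else 0)) ≤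
      ENNReal.ofReal (weight α β w * f w * (p * ((if ∀ j, w.1 j ≠ w.1 i + 1 then 0 else 1) +
          (if ∀ j, w.1 j ≠ w.1 i - 1 then Real.exp (-tilt m α β i) else 0)) +
        q * ((if ∀ j, w.1 j ≠ w.1 i - 1 then 0 else 1) +
          (if ∀ j, w.1 j ≠ w.1 i + 1 then Real.exp (tilt m α β i) else 0)))) := by
    intro i _
    rw [ENNReal.tsum_mul_left, ENNReal.tsum_add, ENNReal.tsum_mul_left, ENNReal.tsum_mul_left]
    refine (mul_le_mul_right (add_le_add
      (mul_le_mul_right (tsum_weight_moveRight_le α β i w) _)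
      (mul_le_mul_right (tsum_weight_moveLeft_le α β i w) _)) _).trans (le_of_eq ?_)
    rw [← ENNReal.ofReal_mul hp, ← ENNReal.ofReal_mul hq,
      ← ENNReal.ofReal_add (mul_nonneg hp (mul_nonneg (hw w) (hR i)))
        (mul_nonneg hq (mul_nonneg (hw w) (hL i))), ← ENNReal.ofReal_mul (hf w)]
    congr 1
    ring
  refine (Finset.sum_le_sum step).trans ?_
  rw [← ENNReal.ofReal_sum_of_nonneg fun i _ => mul_nonneg (mul_nonneg (hw w) (hf w))
    (add_nonneg (mul_nonneg hp (hR i)) (mul_nonneg hq (hL i))), ← Finset.mul_sum,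
    mul_comm, ENNReal.ofReal_mul' (mul_nonneg (hw w) (hf w))]
  gcongr
  exact sum_rates_le_growth hp hq hpq hα hβ w

include hp hq hpq hα hβ in
theorem tsum_weight_mul_jumpOp_pow_le {f : Config (m + 1) → ℝ} (hf : ∀ x, 0 ≤ f x) (k : ℕ) :
    ∑' y, ENNReal.ofReal (weight α β y * (jumpOp p q (m + 1) ^ k) f y) ≤
      ENNReal.ofReal (growth p q m α β) ^ k * ∑' y, ENNReal.ofReal (weight α β y * f y) := by
  induction k with
  | zero => simp
  | succ k ih =>
    simp only [jumpOp_pow_succ]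
    refine (tsum_weight_mul_jumpOp_le hp hq hpq hα hβ (jumpOp_pow_nonneg hp hq hf k)).trans ?_
    rw [pow_succ', mul_assoc]
    gcongr

end Growth

end

/-! ### Gap coordinates and geometric sums -/

section

variable {m : ℕ}

theorem partialSum_last {M : Type*} [AddCommMonoid M] {n : ℕ} (f : Fin n → M) :
    Fin.partialSum f (Fin.last n) = ∑ i, f i := by
  rw [Fin.partialSum, Fin.val_last, List.take_of_length_le (by simp), List.sum_ofFn]

/-- The configuration with leftmost particle at `a` and gaps `g`. -/
def ofGaps (u : ℤ × (Fin m → ℕ)) : Config (m + 1) :=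
  ⟨fun i => u.1 + Fin.partialSum (fun j => (u.2 j : ℤ) + 1) i, by
    rw [Fin.strictMono_iff_lt_succ]
    intro i
    rw [Fin.partialSum_succ]
    omega⟩

theorem ofGaps_zero (u : ℤ × (Fin m → ℕ)) : (ofGaps u).1 0 = u.1 := by
  simp [ofGaps, Fin.partialSum_zero]

theorem ofGaps_last (u : ℤ × (Fin m → ℕ)) :
    (ofGaps u).1 (Fin.last m) = u.1 + m + ((∑ j, u.2 j : ℕ) : ℤ) := by
  simp only [ofGaps, partialSum_last, Finset.sum_add_distrib]
  simp
  ring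

theorem bijective_ofGaps : Function.Bijective (ofGaps : ℤ × (Fin m → ℕ) → Config (m + 1)) := by
  constructor
  · rintro ⟨a, g⟩ ⟨b, h⟩ huv
    have hab : a = b := by
      have := ofGaps_zero (a, g)
      rw [huv, ofGaps_zero] at this
      exact this.symm
    subst hab
    congr 1
    ext j
    have h1 : ∀ i, (ofGaps (a, g)).1 i = (ofGaps (a, h)).1 i := fun i => by rw [huv]
    have h2 := h1 j.castSucc
    have h3 := h1 j.succ
    simp only [ofGaps, Fin.partialSum_succ] at h2 h3
    omega
  · intro y
    refine ⟨(y.1 0, fun j => (y.1 j.succ - y.1 j.castSucc - 1).toNat), ?_⟩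
    ext i
    induction i using Fin.induction with
    | zero => simp [ofGaps, Fin.partialSum_zero]
    | succ j ih =>
      have := y.2 (Fin.castSucc_lt_succ (i := j))
      simp only [ofGaps, Fin.partialSum_succ] at ih ⊢
      omega

theorem tsum_config_eq (F : Config (m + 1) → ℝ≥0∞) :
    ∑' y, F y = ∑' (g : Fin m → ℕ) (a : ℤ), F (ofGaps (a, g)) := by
  rw [← (Equiv.ofBijective _ (bijective_ofGaps (m := m))).tsum_eq F, ENNReal.tsum_prod',
    ENNReal.tsum_comm]
  rfl

theorem tsum_pow_sum_eq (r : ℝ≥0∞) (m : ℕ) :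
    ∑' g : Fin m → ℕ, r ^ (∑ j, g j) = (∑' k : ℕ, r ^ k) ^ m := by
  induction m with
  | zero => simp
  | succ m ih =>
    rw [← (Fin.consEquiv (fun _ : Fin (m + 1) => ℕ)).tsum_eq, ENNReal.tsum_prod', pow_succ', ← ih,
      ← ENNReal.tsum_mul_right]
    refine tsum_congr fun k => ?_
    rw [← ENNReal.tsum_mul_left]
    refine tsum_congr fun g => ?_
    simp [Fin.consEquiv, Fin.sum_univ_succ, pow_add]

/-- The geometric series of ratio `exp (-ε)`. -/
noncomputable def geom (ε : ℝ) : ℝ≥0∞ := ∑' k : ℕ, ENNReal.ofReal (Real.exp (-ε)) ^ k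

theorem geom_eq {ε : ℝ} (hε : 0 < ε) : geom ε = ENNReal.ofReal ((1 - Real.exp (-ε))⁻¹) := by
  have h : Real.exp (-ε) < 1 := by
    rw [← Real.exp_zero, Real.exp_lt_exp]; linarith
  rw [geom, ENNReal.tsum_geometric, ENNReal.ofReal_inv_of_pos (by linarith),
    ENNReal.ofReal_sub _ (Real.exp_pos _).le, ENNReal.ofReal_one]

theorem geom_ne_top {ε : ℝ} (hε : 0 < ε) : geom ε ≠ ∞ := by
  rw [geom_eq hε]
  exact ENNReal.ofReal_ne_top

theorem geom_ne_zero {ε : ℝ} (hε : 0 < ε) : geom ε ≠ 0 := by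
  have h : Real.exp (-ε) < 1 := by
    rw [← Real.exp_zero, Real.exp_lt_exp]; linarith
  rw [geom_eq hε, Ne, ENNReal.ofReal_eq_zero, not_le, inv_pos]
  linarith

/-- With r = exp(-ε) this is 1 + r ≤ 2. It is the price per gap of the comparison, uniform in ε, and
the source of the factor 2^m in the tails. -/
theorem geom_le_two_mul {ε : ℝ} (hε : 0 < ε) : geom ε ≤ 2 * geom (2 * ε) := by
  have h : Real.exp (-ε) < 1 := by
    rw [← Real.exp_zero, Real.exp_lt_exp]; linarith
  have h0 := Real.exp_pos (-ε)
  rw [geom_eq hε, geom_eq (by linarith : 0 < 2 * ε),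
    show (2 : ℝ≥0∞) = ENNReal.ofReal 2 by simp, ← ENNReal.ofReal_mul (by norm_num)]
  refine ENNReal.ofReal_le_ofReal ?_
  rw [show -(2 * ε) = -ε + -ε by ring, Real.exp_add, ← div_eq_mul_inv,
    le_div_iff₀ (by nlinarith), inv_mul_le_iff₀ (by linarith)]
  nlinarith

theorem tsum_pow_sum_geom (ε : ℝ) (m : ℕ) :
    ∑' g : Fin m → ℕ, ENNReal.ofReal (Real.exp (-(ε * (∑ j, g j : ℕ)))) = geom ε ^ m := by
  rw [geom, ← tsum_pow_sum_eq]
  refine tsum_congr fun g => ?_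
  rw [← ENNReal.ofReal_pow (Real.exp_pos _).le, ← Real.exp_nat_mul]
  congr 2
  ring

theorem tsum_exp_le (ε : ℝ) (c : ℤ) :
    ∑' a : ℤ, (if a ≤ c then ENNReal.ofReal (Real.exp (ε * a)) else 0) =
      ENNReal.ofReal (Real.exp (ε * c)) * geom ε := by
  have hinj : Function.Injective fun k : ℕ => c - (k : ℤ) := fun k l h => by
    simp only at h; omega
  rw [← hinj.tsum_eq, geom, ← ENNReal.tsum_mul_left]
  · refine tsum_congr fun k => ?_
    rw [if_pos (by omega), ← ENNReal.ofReal_pow (Real.exp_pos _).le, ← Real.exp_nat_mul,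
      ← ENNReal.ofReal_mul (Real.exp_pos _).le, ← Real.exp_add]
    congr 2
    push_cast
    ring
  · intro a ha
    have : a ≤ c := by
      by_contra h
      simp [h] at ha
    exact ⟨(c - a).toNat, by simp only; omega⟩

theorem tsum_exp_ge (ε : ℝ) (c : ℤ) :
    ∑' a : ℤ, (if c ≤ a then ENNReal.ofReal (Real.exp (-(ε * a))) else 0) =
      ENNReal.ofReal (Real.exp (-(ε * c))) * geom ε := by
  rw [← (Equiv.neg ℤ).tsum_eq]
  have h := tsum_exp_le ε (-c)
  push_cast at h
  rw [← mul_neg, ← h]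
  refine tsum_congr fun a => ?_
  simp only [Equiv.neg_apply]
  push_cast
  simp only [mul_neg, neg_neg, le_neg]

/-! ### Tails at a fixed time -/

/-- If an order-preserving comparison bounds `f` at `x₀` from above by `f` on a set `S` of positive
finite weight, then the weight controls the semigroup at `x₀`. -/
theorem semigroup_le_of_weight {p q α β : ℝ} (hp : 0 ≤ p) (hq : 0 ≤ q) (hpq : p + q = 1)
    (hα : 0 ≤ α) (hβ : β ≤ 0) {f : Config (m + 1) → ℝ} (hf : ∀ x, 0 ≤ f x) {B : ℝ}
    (hB : ∀ x, |f x| ≤ B) {x₀ : Config (m + 1)} {S : Config (m + 1) → Prop} [DecidablePred S]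
    (hS : ∀ k, ∀ y, S y → (jumpOp p q (m + 1) ^ k) f x₀ ≤ (jumpOp p q (m + 1) ^ k) f y)
    {R : ℝ} (hR : 0 ≤ R)
    (h0 : ∑' y, (if S y then ENNReal.ofReal (weight α β y) else 0) ≠ 0)
    (htop : ∑' y, (if S y then ENNReal.ofReal (weight α β y) else 0) ≠ ∞)
    (hle : ∑' y, ENNReal.ofReal (weight α β y * f y) ≤
      ENNReal.ofReal R * ∑' y, (if S y then ENNReal.ofReal (weight α β y) else 0))
    {t : ℝ} (ht : 0 ≤ t) :
    semigroup p q t f x₀ ≤ Real.exp ((growth p q m α β - (m + 1)) * t) * R := by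
  have hΛ : 0 ≤ growth p q m α β :=
    (Finset.sum_nonneg fun i _ => add_nonneg (mul_nonneg hp (Real.exp_pos _).le)
      (mul_nonneg hq (Real.exp_pos _).le)).trans
      (sum_exp_tilt_le (m := m) hp hq hpq hα hβ)
  have key : ∀ k, (jumpOp p q (m + 1) ^ k) f x₀ ≤ growth p q m α β ^ k * R := by
    intro k
    have hu := jumpOp_pow_nonneg hp hq hf k
    have h1 : ENNReal.ofReal ((jumpOp p q (m + 1) ^ k) f x₀) *
        ∑' y, (if S y then ENNReal.ofReal (weight α β y) else 0) ≤
        ENNReal.ofReal (growth p q m α β ^ k * R) *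
          ∑' y, (if S y then ENNReal.ofReal (weight α β y) else 0) := by
      -- Average the comparison over S, drop the restriction to S by positivity, then apply
      -- subinvariance.
      calc _ ≤ ∑' y, ENNReal.ofReal (weight α β y * (jumpOp p q (m + 1) ^ k) f y) := by
            rw [← ENNReal.tsum_mul_left]
            refine ENNReal.tsum_le_tsum fun y => ?_
            split_ifs with hy
            · rw [← ENNReal.ofReal_mul (hu _), mul_comm]
              exact ENNReal.ofReal_le_ofReal
                (mul_le_mul_of_nonneg_left (hS k y hy) (Real.exp_pos _).le)
            · simp
        _ ≤ _ := tsum_weight_mul_jumpOp_pow_le hp hq hpq hα hβ hf k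
        _ ≤ _ := by
            rw [ENNReal.ofReal_mul (by positivity), ENNReal.ofReal_pow hΛ, mul_assoc]
            gcongr
    rw [ENNReal.mul_le_mul_iff_left h0 htop] at h1
    exact (ENNReal.ofReal_le_ofReal_iff (by positivity)).mp h1
  have := semigroup_le_of_jumpOp_pow_le hp hq hpq hB ht x₀ key
  push_cast at this
  exact this

/-- Second-order expansion, exp x - 1 ≤ x + x² for |x| ≤ 1. The linear part is the drift. -/
theorem growth_sub_le {p q α β : ℝ} (hp : 0 ≤ p) (hq : 0 ≤ q) (hpq : p + q = 1)
    (hα : |α| ≤ 1) (hβ : |β| ≤ 1) :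
    growth p q m α β - (m + 1) ≤ -(p - q) * (α + β) + (α ^ 2 + β ^ 2) := by
  have h : ∀ x : ℝ, |x| ≤ 1 → Real.exp x - 1 ≤ x + x ^ 2 := fun x hx => by
    have := (abs_le.mp (Real.abs_exp_sub_one_sub_id_le hx)).2
    linarith
  have h1 := mul_le_mul_of_nonneg_left (h α hα) hq
  have h2 := mul_le_mul_of_nonneg_left (h (-α) (by rwa [abs_neg])) hp
  have h3 := mul_le_mul_of_nonneg_left (h β hβ) hq
  have h4 := mul_le_mul_of_nonneg_left (h (-β) (by rwa [abs_neg])) hp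
  unfold growth
  obtain rfl : q = 1 - p := by linarith
  nlinarith

section Tail

variable {p q ε t : ℝ} (hp : 0 ≤ p) (hq : 0 ≤ q) (hpq : p + q = 1) (hε : 0 < ε) (hε1 : ε ≤ 1 / 2)
  (ht : 0 ≤ t)

include hp hq hpq hε hε1 ht in
/-- Lower tail of the leftmost particle. -/
theorem semigroup_first_le (A : ℤ) :
    semigroup p q t (fun y : Config (m + 1) => if y.1 0 ≤ A then 1 else 0) (packed (m + 1)) ≤
      Real.exp ((-(p - q) * ε + 5 * ε ^ 2) * t) * (Real.exp (ε * (A - 1)) * 2 ^ m) := by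
  have hf0 : ∀ y : Config (m + 1), (0 : ℝ) ≤ if y.1 0 ≤ A then 1 else 0 := fun y => by
    split_ifs <;> norm_num
  have hB : ∀ y : Config (m + 1), |(if y.1 0 ≤ A then 1 else 0 : ℝ)| ≤ 1 := fun y => by
    split_ifs <;> norm_num
  have hanti : Antitone fun y : Config (m + 1) => (if y.1 0 ≤ A then 1 else 0 : ℝ) := by
    intro x y hxy
    have h0 : x.1 0 ≤ y.1 0 := hxy 0
    simp only
    split_ifs <;> first | omega | norm_num
  -- Particles occupy distinct integer sites, so bounding the last one by m + 1 puts all of y below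
  -- the packed configuration.
  have hS : ∀ k, ∀ y : Config (m + 1), y.1 (Fin.last m) ≤ m + 1 →
      (jumpOp p q (m + 1) ^ k) (fun y => if y.1 0 ≤ A then 1 else 0) (packed (m + 1)) ≤
      (jumpOp p q (m + 1) ^ k) (fun y => if y.1 0 ≤ A then 1 else 0) y := by
    intro k y hy
    refine antitone_jumpOp_pow hp hq hanti k fun i => ?_
    show y.1 i ≤ ((i : ℕ) : ℤ) + 1
    induction i using Fin.reverseInduction with
    | last => simpa using hy
    | cast j ih =>
      have := y.2 (Fin.castSucc_lt_succ (i := j))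
      simp at ih ⊢
      omega
  -- With leftmost site a and total gap s, the exponent is εa - ε(m + s). So α + β = ε > 0 gives
  -- convergence as a → -∞, and β = -ε < 0 gives convergence over the gaps.
  have e1 : ∑' y : Config (m + 1), ENNReal.ofReal
      (weight (2 * ε) (-ε) y * (if y.1 0 ≤ A then 1 else 0)) =
      ENNReal.ofReal (Real.exp (ε * (A - m))) * geom ε * geom ε ^ m := by
    rw [tsum_config_eq, ← tsum_pow_sum_geom, ← ENNReal.tsum_mul_left]
    refine tsum_congr fun g => ?_
    have : ENNReal.ofReal (Real.exp (ε * (A - m))) =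
        ENNReal.ofReal (Real.exp (-(ε * m))) * ENNReal.ofReal (Real.exp (ε * A)) := by
      rw [← ENNReal.ofReal_mul (Real.exp_pos _).le, ← Real.exp_add]
      ring_nf
    rw [this, mul_assoc (ENNReal.ofReal _), ← tsum_exp_le, ← ENNReal.tsum_mul_left,
      ← ENNReal.tsum_mul_right]
    refine tsum_congr fun a => ?_
    rw [ofGaps_zero, weight, ofGaps_zero, ofGaps_last]
    split_ifs
    · rw [mul_one, ← ENNReal.ofReal_mul (Real.exp_pos _).le, ← Real.exp_add,
        ← ENNReal.ofReal_mul (Real.exp_pos _).le, ← Real.exp_add]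
      congr 2
      push_cast
      ring
    · simp
  -- Here the last particle is constrained, so a ≤ 1 - s. Summing over a costs another exp(-εs), and
  -- the gaps decay at rate 2ε.
  have e2 : ∑' y : Config (m + 1), (if y.1 (Fin.last m) ≤ m + 1 then
      ENNReal.ofReal (weight (2 * ε) (-ε) y) else 0) =
      ENNReal.ofReal (Real.exp (ε * (1 - m))) * geom ε * geom (2 * ε) ^ m := by
    rw [tsum_config_eq, ← tsum_pow_sum_geom, ← ENNReal.tsum_mul_left]
    refine tsum_congr fun g => ?_
    have : ENNReal.ofReal (Real.exp (ε * (1 - m))) * geom ε *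
          ENNReal.ofReal (Real.exp (-(2 * ε * (∑ j, g j : ℕ)))) =
        ENNReal.ofReal (Real.exp (-(ε * (m + (∑ j, g j : ℕ))))) *
        (ENNReal.ofReal (Real.exp (ε * ((1 - (∑ j, g j : ℕ) : ℤ)))) * geom ε) := by
      rw [mul_right_comm, ← mul_assoc, ← ENNReal.ofReal_mul (Real.exp_pos _).le, ← Real.exp_add,
        ← ENNReal.ofReal_mul (Real.exp_pos _).le, ← Real.exp_add]
      congr 3
      push_cast
      ring
    rw [this, ← tsum_exp_le, ← ENNReal.tsum_mul_left]
    refine tsum_congr fun a => ?_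
    rw [weight, ofGaps_zero, ofGaps_last, mul_ite, mul_zero]
    refine if_congr (by dsimp only; constructor <;> intro h <;> omega) ?_ rfl
    rw [← ENNReal.ofReal_mul (Real.exp_pos _).le, ← Real.exp_add]
    congr 2
    push_cast
    ring
  have hgm : geom (2 * ε) ^ m ≠ ∞ := ENNReal.pow_ne_top (geom_ne_top (by linarith))
  refine (semigroup_le_of_weight hp hq hpq (α := 2 * ε) (β := -ε) (by linarith) (by linarith)
    hf0 hB (S := fun y => y.1 (Fin.last m) ≤ m + 1) hS
    (R := Real.exp (ε * (A - 1)) * 2 ^ m) (by positivity) ?_ ?_ ?_ ht).trans ?_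
  · rw [e2]
    refine mul_ne_zero (mul_ne_zero ?_ (geom_ne_zero hε)) (pow_ne_zero _ (geom_ne_zero (by linarith)))
    simpa using Real.exp_pos _
  · rw [e2]
    exact ENNReal.mul_ne_top (ENNReal.mul_ne_top ENNReal.ofReal_ne_top (geom_ne_top hε)) hgm
  · rw [e1, e2, ENNReal.ofReal_mul (Real.exp_pos _).le]
    calc _ ≤ ENNReal.ofReal (Real.exp (ε * (A - m))) * geom ε * (2 * geom (2 * ε)) ^ m := by
          gcongr
          exact geom_le_two_mul hε
      _ = _ := by
          rw [show ε * (A - m) = ε * (A - 1) + ε * (1 - m) by ring, Real.exp_add,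
            ENNReal.ofReal_mul (Real.exp_pos _).le, mul_pow, ENNReal.ofReal_pow (by norm_num),
            ENNReal.ofReal_ofNat]
          ring
  · gcongr
    refine (growth_sub_le hp hq hpq ?_ ?_).trans (le_of_eq (by ring))
    · rw [abs_of_pos] <;> linarith
    · rw [abs_neg, abs_of_pos] <;> linarith

include hp hq hpq hε hε1 ht in
/-- Upper tail of the rightmost particle. -/
theorem semigroup_last_le (A : ℤ) :
    semigroup p q t (fun y : Config (m + 1) => if A ≤ y.1 (Fin.last m) then 1 else 0)
        (packed (m + 1)) ≤
      Real.exp (((p - q) * ε + 5 * ε ^ 2) * t) * (Real.exp (-(ε * (A - m - 1))) * 2 ^ m) := by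
  have hf0 : ∀ y : Config (m + 1), (0 : ℝ) ≤ if A ≤ y.1 (Fin.last m) then 1 else 0 := fun y => by
    split_ifs <;> norm_num
  have hB : ∀ y : Config (m + 1), |(if A ≤ y.1 (Fin.last m) then 1 else 0 : ℝ)| ≤ 1 := fun y => by
    split_ifs <;> norm_num
  have hmono : Monotone fun y : Config (m + 1) => (if A ≤ y.1 (Fin.last m) then 1 else 0 : ℝ) := by
    intro x y hxy
    have h0 : x.1 (Fin.last m) ≤ y.1 (Fin.last m) := hxy (Fin.last m)
    simp only
    split_ifs <;> first | omega | norm_num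
  have hS : ∀ k, ∀ y : Config (m + 1), 1 ≤ y.1 0 →
      (jumpOp p q (m + 1) ^ k) (fun y => if A ≤ y.1 (Fin.last m) then 1 else 0) (packed (m + 1)) ≤
      (jumpOp p q (m + 1) ^ k) (fun y => if A ≤ y.1 (Fin.last m) then 1 else 0) y := by
    intro k y hy
    refine monotone_jumpOp_pow hp hq hmono k fun i => ?_
    show ((i : ℕ) : ℤ) + 1 ≤ y.1 i
    induction i using Fin.induction with
    | zero => simpa using hy
    | succ j ih =>
      have := y.2 (Fin.castSucc_lt_succ (i := j))
      simp at ih ⊢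
      omega
  -- Mirror image: α + β = -ε gives convergence as a → +∞. The constraint a ≥ A - m - s returns
  -- exp(εs), leaving gap rate ε, against 2ε on S.
  have e1 : ∑' y : Config (m + 1), ENNReal.ofReal
      (weight ε (-(2 * ε)) y * (if A ≤ y.1 (Fin.last m) then 1 else 0)) =
      ENNReal.ofReal (Real.exp (-(ε * (A + m)))) * geom ε * geom ε ^ m := by
    rw [tsum_config_eq, ← tsum_pow_sum_geom, ← ENNReal.tsum_mul_left]
    refine tsum_congr fun g => ?_
    have : ENNReal.ofReal (Real.exp (-(ε * (A + m)))) * geom ε *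
          ENNReal.ofReal (Real.exp (-(ε * (∑ j, g j : ℕ)))) =
        ENNReal.ofReal (Real.exp (-(2 * ε * (m + (∑ j, g j : ℕ))))) *
        (ENNReal.ofReal (Real.exp (-(ε * ((A - m - (∑ j, g j : ℕ) : ℤ))))) * geom ε) := by
      rw [mul_right_comm, ← mul_assoc, ← ENNReal.ofReal_mul (Real.exp_pos _).le, ← Real.exp_add,
        ← ENNReal.ofReal_mul (Real.exp_pos _).le, ← Real.exp_add]
      congr 3
      push_cast
      ring
    rw [this, ← tsum_exp_ge, ← ENNReal.tsum_mul_left]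
    refine tsum_congr fun a => ?_
    rw [weight, ofGaps_zero, ofGaps_last]
    by_cases h : A ≤ a + m + (∑ j, g j : ℕ)
    · rw [if_pos h, if_pos (by omega), mul_one, ← ENNReal.ofReal_mul (Real.exp_pos _).le,
        ← Real.exp_add]
      congr 2
      push_cast
      ring
    · rw [if_neg h, if_neg (by omega)]
      simp
  have e2 : ∑' y : Config (m + 1), (if 1 ≤ y.1 0 then
      ENNReal.ofReal (weight ε (-(2 * ε)) y) else 0) =
      ENNReal.ofReal (Real.exp (-(ε * (1 + 2 * m)))) * geom ε * geom (2 * ε) ^ m := by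
    rw [tsum_config_eq, ← tsum_pow_sum_geom, ← ENNReal.tsum_mul_left]
    refine tsum_congr fun g => ?_
    have : ENNReal.ofReal (Real.exp (-(ε * (1 + 2 * m)))) =
        ENNReal.ofReal (Real.exp (-(2 * ε * m))) *
          ENNReal.ofReal (Real.exp (-(ε * (1 : ℤ)))) := by
      rw [← ENNReal.ofReal_mul (Real.exp_pos _).le, ← Real.exp_add]
      congr 2
      push_cast
      ring
    rw [this, mul_assoc (ENNReal.ofReal _), ← tsum_exp_ge, ← ENNReal.tsum_mul_left,
      ← ENNReal.tsum_mul_right]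
    refine tsum_congr fun a => ?_
    rw [weight, ofGaps_zero, ofGaps_last]
    split_ifs
    · rw [← ENNReal.ofReal_mul (Real.exp_pos _).le, ← Real.exp_add,
        ← ENNReal.ofReal_mul (Real.exp_pos _).le, ← Real.exp_add]
      congr 2
      push_cast
      ring
    · simp
  have hgm : geom (2 * ε) ^ m ≠ ∞ := ENNReal.pow_ne_top (geom_ne_top (by linarith))
  refine (semigroup_le_of_weight hp hq hpq (α := ε) (β := -(2 * ε)) (by linarith) (by linarith)
    hf0 hB (S := fun y => 1 ≤ y.1 0) hS
    (R := Real.exp (-(ε * (A - m - 1))) * 2 ^ m) (by positivity) ?_ ?_ ?_ ht).trans ?_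
  · rw [e2]
    refine mul_ne_zero (mul_ne_zero ?_ (geom_ne_zero hε)) (pow_ne_zero _ (geom_ne_zero (by linarith)))
    simpa using Real.exp_pos _
  · rw [e2]
    exact ENNReal.mul_ne_top (ENNReal.mul_ne_top ENNReal.ofReal_ne_top (geom_ne_top hε)) hgm
  · rw [e1, e2, ENNReal.ofReal_mul (Real.exp_pos _).le]
    calc _ ≤ ENNReal.ofReal (Real.exp (-(ε * (A + m)))) * geom ε * (2 * geom (2 * ε)) ^ m := by
          gcongr
          exact geom_le_two_mul hε
      _ = _ := by
          rw [show -(ε * (A + m)) = -(ε * (A - m - 1)) + -(ε * (1 + 2 * m)) by ring, Real.exp_add,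
            ENNReal.ofReal_mul (Real.exp_pos _).le, mul_pow, ENNReal.ofReal_pow (by norm_num),
            ENNReal.ofReal_ofNat]
          ring
  · gcongr
    refine (growth_sub_le hp hq hpq ?_ ?_).trans (le_of_eq (by ring))
    · rw [abs_of_pos] <;> linarith
    · rw [abs_neg, abs_of_pos] <;> linarith

end Tail

end

/-! ### Maximal inequality -/

theorem measurableSet_past {Ω : Type*} {n : ℕ} {η : ℝ≥0 → Ω → Config n} {s t : ℝ≥0} (hst : s ≤ t) (S : Set (Config n)) :
    MeasurableSet[past η t] (η s ⁻¹' S) := by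
  have h : MeasurableSpace.comap (η s) inferInstance ≤ past η t :=
    le_iSup₂_of_le (f := fun u (_ : u ≤ t) => MeasurableSpace.comap (η u) inferInstance)
      s hst le_rfl
  exact h _ ⟨S, MeasurableSet.of_discrete, rfl⟩

section Maximal

variable {Ω : Type*} [MeasurableSpace Ω] {P : Measure Ω} {p q : ℝ}
  {n : ℕ} {x₀ : Config n} {η : ℝ≥0 → Ω → Config n}

theorem IsASEP.past_le (H : IsASEP P p q x₀ η) (s : ℝ≥0) : past η s ≤ ‹MeasurableSpace Ω› :=
  iSup₂_le fun u _ => (H.measurable u).comap_le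

theorem setIntegral_ite_comp (S : Config n → Prop) [DecidablePred S] {T : ℝ≥0}
    (hT : Measurable (η T)) (B : Set Ω) :
    ∫ ω in B, (if S (η T ω) then (1 : ℝ) else 0) ∂P = P.real (B ∩ η T ⁻¹' {x | S x}) := by
  have hE : MeasurableSet (η T ⁻¹' {x | S x}) := hT MeasurableSet.of_discrete
  have : (fun ω => if S (η T ω) then (1 : ℝ) else 0) =
      (η T ⁻¹' {x | S x}).indicator fun _ => (1 : ℝ) := by
    ext ω
    by_cases h : S (η T ω) <;> simp [Set.indicator, h]
  rw [this, setIntegral_indicator hE]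
  simp

variable [IsProbabilityMeasure P]

theorem integrable_ite_comp (S : Config n → Prop) [DecidablePred S] {T : ℝ≥0}
    (hT : Measurable (η T)) : Integrable (fun ω => if S (η T ω) then (1 : ℝ) else 0) P := by
  refine Integrable.of_bound (C := 1)
    ((measurable_of_countable (fun x : Config n => if S x then (1 : ℝ) else 0)).comp
      hT).aestronglyMeasurable (ae_of_all _ fun ω => ?_)
  split_ifs <;> simp

theorem exists_bound_ite (S : Config n → Prop) [DecidablePred S] :
    ∃ B : ℝ, ∀ x : Config n, |if S x then (1 : ℝ) else 0| ≤ B :=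
  ⟨1, fun x => by split_ifs <;> simp⟩

/-- The law of the process at a fixed time is given by the semigroup. -/
theorem IsASEP.measureReal_eq_semigroup (H : IsASEP P p q x₀ η) (S : Config n → Prop)
    [DecidablePred S] (T : ℝ≥0) :
    P.real (η T ⁻¹' {x | S x}) = semigroup p q T (fun x => if S x then 1 else 0) x₀ := by
  have h1 := H.markov 0 T (fun x => if S x then 1 else 0) (exists_bound_ite S)
  simp only [zero_add] at h1
  have h2 := integral_condExp (H.past_le 0) (μ := P)
    (f := fun ω => if S (η T ω) then (1 : ℝ) else 0)
  have h3 := setIntegral_ite_comp (P := P) S (H.measurable T) Set.univ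
  rw [setIntegral_univ, Set.univ_inter] at h3
  rw [← h3, ← h2, integral_congr_ae h1,
    integral_congr_ae (g := fun _ => semigroup p q T (fun x => if S x then 1 else 0) x₀)
      (H.start.mono fun ω hω => by simp only [hω])]
  simp

theorem IsASEP.measure_le_two_mul_of_half_le (H : IsASEP P p q x₀ η) (S : Config n → Prop)
    [DecidablePred S] {t T : ℝ≥0} (htT : t ≤ T) {B : Set Ω} (hB : MeasurableSet[past η t] B)
    (hS : ∀ ω ∈ B, 1 / 2 ≤ semigroup p q ((T - t : ℝ≥0) : ℝ) (fun x => if S x then 1 else 0)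
      (η t ω)) :
    P B ≤ 2 * P (B ∩ η T ⁻¹' {x | S x}) := by
  have hB' := H.past_le t _ hB
  have h1 := H.markov t (T - t) (fun x => if S x then 1 else 0) (exists_bound_ite S)
  rw [add_tsub_cancel_of_le htT] at h1
  have hint : Integrable (fun ω => semigroup p q ((T - t : ℝ≥0) : ℝ)
      (fun x => if S x then 1 else 0) (η t ω)) P := integrable_condExp.congr h1
  have h2 := setIntegral_condExp (H.past_le t) (integrable_ite_comp S (H.measurable T)) hB
    (μ := P)
  rw [setIntegral_ite_comp S (H.measurable T) B, setIntegral_congr_ae hB' (h1.mono fun _ h _ => h)]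
    at h2
  have h3 := setIntegral_mono_on (μ := P) (f := fun _ => (1 / 2 : ℝ)) integrableOn_const
    hint.integrableOn hB' hS
  rw [h2] at h3
  simp only [integral_const, MeasurableSet.univ, measureReal_restrict_apply, Set.univ_inter,
    smul_eq_mul] at h3
  have h4 : P.real B ≤ 2 * P.real (B ∩ η T ⁻¹' {x | S x}) := by linarith
  rw [← ofReal_measureReal (μ := P) (s := B), ← ofReal_measureReal (μ := P) (s := B ∩ _),
    ← ENNReal.ofReal_ofNat, ← ENNReal.ofReal_mul (by norm_num)]
  exact ENNReal.ofReal_le_ofReal h4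

/-- An Ottaviani-type maximal inequality over finitely many times. -/
theorem IsASEP.measure_biUnion_le (H : IsASEP P p q x₀ η) (S U : Config n → Prop)
    [DecidablePred S] {T : ℝ≥0} (F : Finset ℝ≥0) (hF : ∀ t ∈ F, t ≤ T)
    (hS : ∀ t ∈ F, ∀ x, U x →
      1 / 2 ≤ semigroup p q ((T - t : ℝ≥0) : ℝ) (fun x => if S x then 1 else 0) x) :
    P (⋃ t ∈ F, η t ⁻¹' {x | U x}) ≤ 2 * P (η T ⁻¹' {x | S x}) := by
  -- Decomposition by the first time in F at which U holds: each piece belongs to the past of its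
  -- time, and the pieces are disjoint.
  set B : ℝ≥0 → Set Ω := fun t =>
    η t ⁻¹' {x | U x} \ ⋃ s ∈ F.filter (· < t), η s ⁻¹' {x | U x} with hBdef
  have hBm : ∀ t, MeasurableSet[past η t] (B t) := fun t =>
    MeasurableSet.diff (measurableSet_past le_rfl _)
      (Finset.measurableSet_biUnion _ fun s hs =>
        measurableSet_past (Finset.mem_filter.mp hs).2.le _)
  have hcover : (⋃ t ∈ F, η t ⁻¹' {x | U x}) ⊆ ⋃ t ∈ F, B t := by
    classical
    intro ω hω
    simp only [Set.mem_iUnion] at hω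
    obtain ⟨t, htF, ht⟩ := hω
    have hne : (F.filter fun t => U (η t ω)).Nonempty := ⟨t, Finset.mem_filter.mpr ⟨htF, ht⟩⟩
    have hmem := Finset.mem_filter.mp (Finset.min'_mem _ hne)
    simp only [Set.mem_iUnion]
    refine ⟨_, hmem.1, hmem.2, ?_⟩
    simp only [Set.mem_iUnion, not_exists]
    intro s hs hsU
    rw [Finset.mem_filter] at hs
    exact (Finset.min'_le _ s (Finset.mem_filter.mpr ⟨hs.1, hsU⟩)).not_gt hs.2
  have hdisj : Set.PairwiseDisjoint (F : Set ℝ≥0) fun t => B t ∩ η T ⁻¹' {x | S x} := by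
    have key : ∀ s ∈ F, ∀ t, s < t → Disjoint (B s) (B t) := fun s hs t hst => by
      rw [Set.disjoint_left]
      intro ω h1 h2
      exact h2.2 (Set.mem_biUnion (Finset.mem_filter.mpr ⟨hs, hst⟩) h1.1)
    intro s hs t ht hst
    refine Disjoint.mono Set.inter_subset_left Set.inter_subset_left ?_
    rcases lt_or_gt_of_ne hst with h | h
    · exact key s hs t h
    · exact (key t ht s h).symm
  calc _ ≤ P (⋃ t ∈ F, B t) := measure_mono hcover
    _ ≤ ∑ t ∈ F, P (B t) := measure_biUnion_finset_le _ _
    _ ≤ ∑ t ∈ F, 2 * P (B t ∩ η T ⁻¹' {x | S x}) := Finset.sum_le_sum fun t ht =>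
        H.measure_le_two_mul_of_half_le S (hF t ht) (hBm t) fun ω hω => hS t ht _ hω.1
    _ = 2 * P (⋃ t ∈ F, B t ∩ η T ⁻¹' {x | S x}) := by
        rw [← Finset.mul_sum, measure_biUnion_finset hdisj fun t _ =>
          (H.past_le t _ (hBm t)).inter (H.measurable T MeasurableSet.of_discrete)]
    _ ≤ _ := by
        gcongr
        exact Set.iUnion₂_subset fun t _ => Set.inter_subset_right

/-- Configurations are discrete and paths right-continuous, so a visit to U lasts for a short
interval to the right and is seen at a countable dense set of times. The strict bound t < a + 1
leaves room for that interval inside the window. -/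
theorem IsASEP.measure_window_le (H : IsASEP P p q x₀ η) (S U : Config n → Prop)
    [DecidablePred S] (a : ℝ≥0)
    (hS : ∀ s : ℝ≥0, s ≤ 1 → ∀ x, U x →
      1 / 2 ≤ semigroup p q s (fun x => if S x then 1 else 0) x) :
    P {ω | ∃ t : ℝ≥0, a ≤ t ∧ t < a + 1 ∧ U (η t ω)} ≤
      2 * ENNReal.ofReal (semigroup p q ((a + 1 : ℝ≥0) : ℝ) (fun x => if S x then 1 else 0) x₀) := by
  classical
  -- A dense sequence clamped to the window, so that every sampled time is within one unit of the
  -- end.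
  set τ : ℕ → ℝ≥0 := fun i => max a (min (TopologicalSpace.denseSeq ℝ≥0 i) (a + 1)) with hτ
  have hτa : ∀ i, a ≤ τ i := fun i => le_max_left _ _
  have hτT : ∀ i, τ i ≤ a + 1 := fun i => max_le le_self_add (min_le_right _ _)
  have h1 : P (⋃ i, η (τ i) ⁻¹' {x | U x}) ≤ 2 * P (η (a + 1) ⁻¹' {x | S x}) := by
    rw [measure_iUnion_eq_iSup_accumulate]
    refine iSup_le fun i => ?_
    have : Set.accumulate (fun i => η (τ i) ⁻¹' {x | U x}) i =
        ⋃ t ∈ (Finset.range (i + 1)).image τ, η t ⁻¹' {x | U x} := by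
      ext ω
      simp [Set.mem_accumulate]
    rw [this]
    refine H.measure_biUnion_le S U _ (fun t ht => ?_) (fun t ht x hx => ?_)
    · obtain ⟨j, _, rfl⟩ := Finset.mem_image.mp ht
      exact hτT j
    · obtain ⟨j, _, rfl⟩ := Finset.mem_image.mp ht
      refine hS _ ?_ x hx
      rw [tsub_le_iff_left]
      gcongr
      exact hτa j
  rw [← H.measureReal_eq_semigroup S, ofReal_measureReal]
  refine le_trans (measure_mono_ae ?_) h1
  filter_upwards [H.rightCont] with ω hω
  rintro ⟨t, hat, hta, hU⟩
  have hev : ∀ᶠ s in 𝓝[>] t, η s ω = η t ω := by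
    have := (hω t).mono_left (nhdsWithin_mono t Set.Ioi_subset_Ici_self)
    rw [nhds_discrete] at this
    exact this (Set.mem_singleton _)
  obtain ⟨b, hb, hsub⟩ := (mem_nhdsGT_iff_exists_Ioo_subset' hta).mp hev
  have hlt : t < min b (a + 1) := lt_min hb hta
  obtain ⟨i, hs⟩ := (TopologicalSpace.denseRange_denseSeq ℝ≥0).exists_mem_open
    (isOpen_Ioo (a := t) (b := min b (a + 1))) (Set.nonempty_Ioo.mpr hlt)
  refine Set.mem_iUnion.mpr ⟨i, ?_⟩
  have hi : τ i = TopologicalSpace.denseSeq ℝ≥0 i := by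
    rw [hτ]
    simp only
    rw [min_eq_left (hs.2.le.trans (min_le_right _ _)), max_eq_right (hat.trans hs.1.le)]
  have := hsub ⟨hs.1, hs.2.trans_le (min_le_left _ _)⟩
  show U (η (τ i) ω)
  rw [hi]
  have h2 : η (TopologicalSpace.denseSeq ℝ≥0 i) ω = η t ω := this
  rw [h2]
  exact hU

end Maximal

/-! ### Extreme particles over a unit window -/

section Window

variable {Ω : Type*} [MeasurableSpace Ω] {P : Measure Ω} [IsProbabilityMeasure P] {p q : ℝ}
  {m : ℕ} {η : ℝ≥0 → Ω → Config (m + 1)}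

theorem two_pow_le_exp (m : ℕ) : (2 : ℝ) ^ m ≤ Real.exp m := by
  rw [← mul_one (m : ℝ), Real.exp_nat_mul]
  have := Real.add_one_le_exp (1 : ℝ)
  gcongr
  linarith

theorem IsASEP.measure_first_window_le (H : IsASEP P p q (packed (m + 1)) η) (hp : 0 ≤ p)
    (hq : 0 ≤ q) (hpq : p + q = 1) (hqp : q ≤ p) {ε D : ℝ} (hε : 0 < ε) (hε1 : ε ≤ 1 / 2)
    (a : ℝ≥0) :
    P {ω | ∃ t : ℝ≥0, a ≤ t ∧ t < a + 1 ∧ ((η t ω).1 0 : ℝ) < (p - q) * t - D} ≤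
      2 * ENNReal.ofReal (Real.exp (5 * ε ^ 2 * (a + 1) - ε * D + 3 * (m + 1))) := by
  -- The line is evaluated at the right end of the window, where it is highest as p ≥ q. The extra
  -- 2(m + 1) is the room that `half_le_semigroup` needs; together with 2^m it costs at most exp(3(m
  -- + 1)), using ε ≤ 1/2.
  set A : ℤ := ⌈(p - q) * (a + 1) - D⌉ + 2 * (m + 1) with hA
  have hA1 : (A : ℝ) - 1 ≤ (p - q) * (a + 1) - D + 2 * (m + 1) := by
    have := Int.ceil_lt_add_one ((p - q) * ((a : ℝ) + 1) - D)
    rw [hA]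
    push_cast
    linarith
  refine (measure_mono ?_).trans ((H.measure_window_le (fun x => x.1 0 ≤ A)
    (fun x => x.1 0 ≤ A - 2 * (m + 1 : ℕ)) a ?_).trans ?_)
  · rintro ω ⟨t, hat, hta, ht⟩
    refine ⟨t, hat, hta, ?_⟩
    have hta' : (t : ℝ) ≤ a + 1 := by exact_mod_cast hta.le
    have h1 : ((η t ω).1 0 : ℝ) ≤ ⌈(p - q) * (a + 1) - D⌉ := by
      refine le_trans ?_ (Int.le_ceil _)
      nlinarith [mul_le_mul_of_nonneg_left hta' (sub_nonneg.2 hqp)]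
    have h2 : (η t ω).1 0 ≤ ⌈(p - q) * ((a : ℝ) + 1) - D⌉ := by exact_mod_cast h1
    rw [hA]
    push_cast
    linarith
  · intro s hs x hx
    exact half_le_semigroup hp hq hpq (Nat.succ_pos m) (h := fun x => x.1 0)
      (fun i x => moveRight_apply_le i 0 x) (fun i x => (moveLeft_le i x 0).trans (by simp)) hx
      s.2 (by exact_mod_cast hs)
  · gcongr
    refine (semigroup_first_le hp hq hpq hε hε1 (a + 1 : ℝ≥0).2 A).trans ?_
    calc _ ≤ Real.exp ((-(p - q) * ε + 5 * ε ^ 2) * (a + 1 : ℝ≥0)) *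
          (Real.exp (ε * (A - 1)) * Real.exp m) := by
          exact mul_le_mul_of_nonneg_left (mul_le_mul_of_nonneg_left (two_pow_le_exp m)
            (Real.exp_pos _).le) (Real.exp_pos _).le
      _ ≤ _ := by
          rw [← Real.exp_add, ← Real.exp_add, Real.exp_le_exp]
          push_cast
          have h1 := mul_le_mul_of_nonneg_left hA1 hε.le
          have h2 : (0 : ℝ) ≤ m := Nat.cast_nonneg m
          nlinarith

theorem IsASEP.measure_last_window_le (H : IsASEP P p q (packed (m + 1)) η) (hp : 0 ≤ p)
    (hq : 0 ≤ q) (hpq : p + q = 1) (hqp : q ≤ p) {ε D : ℝ} (hε : 0 < ε) (hε1 : ε ≤ 1 / 2)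
    (a : ℝ≥0) :
    P {ω | ∃ t : ℝ≥0, a ≤ t ∧ t < a + 1 ∧ (p - q) * t + D < ((η t ω).1 (Fin.last m) : ℝ)} ≤
      2 * ENNReal.ofReal (Real.exp (5 * ε ^ 2 * (a + 1) - ε * D + 3 * (m + 1))) := by
  -- Here the line is evaluated at the left end, where it is lowest. The missing unit of drift costs
  -- at most ε in the exponent, absorbed in 3(m + 1).
  set A : ℤ := ⌊(p - q) * a + D⌋ - 2 * (m + 1) with hA
  have hA1 : (p - q) * a + D - 1 - 2 * (m + 1) ≤ A := by
    have := Int.sub_one_lt_floor ((p - q) * (a : ℝ) + D)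
    rw [hA]
    push_cast
    linarith
  refine (measure_mono ?_).trans ((H.measure_window_le (fun x => A ≤ x.1 (Fin.last m))
    (fun x => -x.1 (Fin.last m) ≤ -A - 2 * (m + 1 : ℕ)) a ?_).trans ?_)
  · rintro ω ⟨t, hat, hta, ht⟩
    refine ⟨t, hat, hta, ?_⟩
    have hta' : (a : ℝ) ≤ t := by exact_mod_cast hat
    have h1 : (⌊(p - q) * (a : ℝ) + D⌋ : ℝ) ≤ (η t ω).1 (Fin.last m) := by
      refine (Int.floor_le _).trans ?_
      nlinarith [mul_le_mul_of_nonneg_left hta' (sub_nonneg.2 hqp)]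
    have h2 : ⌊(p - q) * (a : ℝ) + D⌋ ≤ (η t ω).1 (Fin.last m) := by exact_mod_cast h1
    rw [hA]
    push_cast
    linarith
  · intro s hs x hx
    have := half_le_semigroup hp hq hpq (Nat.succ_pos m) (h := fun x => -x.1 (Fin.last m))
      (fun i x => by
        have := le_moveRight i x (Fin.last m)
        omega)
      (fun i x => by
        have := le_moveLeft_apply_add_one i (Fin.last m) x
        omega) hx s.2 (by exact_mod_cast hs)
    refine this.trans_eq ?_
    congr 1
    funext y
    exact if_congr neg_le_neg_iff rfl rfl
  · gcongr
    refine (semigroup_last_le hp hq hpq hε hε1 (a + 1 : ℝ≥0).2 A).trans ?_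
    calc _ ≤ Real.exp (((p - q) * ε + 5 * ε ^ 2) * (a + 1 : ℝ≥0)) *
          (Real.exp (-(ε * (A - m - 1))) * Real.exp m) := by
          exact mul_le_mul_of_nonneg_left (mul_le_mul_of_nonneg_left (two_pow_le_exp m)
            (Real.exp_pos _).le) (Real.exp_pos _).le
      _ ≤ _ := by
          rw [← Real.exp_add, ← Real.exp_add, Real.exp_le_exp]
          push_cast
          have h1 := mul_le_mul_of_nonneg_left hA1 hε.le
          have h2 : (0 : ℝ) ≤ m := Nat.cast_nonneg m
          have h3 : ε * (p - q) ≤ ε := by nlinarith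
          nlinarith

end Window

/-! ### Union over windows and choice of parameters -/

/-- A quantitative, non-asymptotic form of the concentration estimate. -/
theorem IsASEP.measure_exists_exceed_le {Ω : Type*} [MeasurableSpace Ω] {P : Measure Ω}
    [IsProbabilityMeasure P] {p q : ℝ} {n : ℕ} (hn : 1 ≤ n) {η : ℝ≥0 → Ω → Config n}
    (H : IsASEP P p q (packed n) η) (hp : 0 ≤ p) (hq : 0 ≤ q) (hpq : p + q = 1) (hqp : q ≤ p)
    {ε D T : ℝ} (hε : 0 < ε) (hε1 : ε ≤ 1 / 2) (hT : 0 ≤ T) :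
    P {ω | ∀ t : ℝ≥0, (t : ℝ) ≤ T → ∀ i : Fin n,
        |(((η t ω).1 i : ℤ) : ℝ) - (p - q) * t| ≤ D}ᶜ ≤
      ENNReal.ofReal (4 * (T + 1) * Real.exp (5 * ε ^ 2 * (T + 1) - ε * D + 3 * n)) := by
  obtain ⟨m, rfl⟩ : ∃ m, n = m + 1 := ⟨n - 1, by omega⟩
  set E := ENNReal.ofReal (Real.exp (5 * ε ^ 2 * (T + 1) - ε * D + 3 * (m + 1 : ℕ))) with hE
  set lo : ℕ → Set Ω := fun k => {ω | ∃ t : ℝ≥0, (k : ℝ≥0) ≤ t ∧ t < k + 1 ∧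
    ((η t ω).1 0 : ℝ) < (p - q) * t - D} with hlo
  set hi : ℕ → Set Ω := fun k => {ω | ∃ t : ℝ≥0, (k : ℝ≥0) ≤ t ∧ t < k + 1 ∧
    (p - q) * t + D < ((η t ω).1 (Fin.last m) : ℝ)} with hhi
  have hsub : {ω | ∀ t : ℝ≥0, (t : ℝ) ≤ T → ∀ i : Fin (m + 1),
      |(((η t ω).1 i : ℤ) : ℝ) - (p - q) * t| ≤ D}ᶜ ⊆
      ⋃ k ∈ Finset.range (⌊T⌋₊ + 1), (lo k ∪ hi k) := by
    intro ω hω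
    simp only [Set.mem_compl_iff, Set.mem_ofPred_eq] at hω
    push Not at hω
    obtain ⟨t, htT, i, hi'⟩ := hω
    have hfl : (⌊t⌋₊ : ℝ≥0) ≤ t := Nat.floor_le t.2
    have hfl' : t < ⌊t⌋₊ + 1 := Nat.lt_floor_add_one t
    have hmem : ⌊t⌋₊ ∈ Finset.range (⌊T⌋₊ + 1) := by
      rw [Finset.mem_range, Nat.lt_succ_iff, Nat.le_floor_iff hT]
      refine le_trans ?_ htT
      exact_mod_cast hfl
    refine Set.mem_biUnion hmem ?_
    have h0 : ((η t ω).1 0 : ℝ) ≤ (η t ω).1 i := by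
      exact_mod_cast (η t ω).2.monotone (Fin.zero_le i)
    have h1 : ((η t ω).1 i : ℝ) ≤ (η t ω).1 (Fin.last m) := by
      exact_mod_cast (η t ω).2.monotone (Fin.le_last i)
    rcases lt_abs.mp hi' with h | h
    · exact Or.inr ⟨t, hfl, hfl', by linarith⟩
    · exact Or.inl ⟨t, hfl, hfl', by linarith⟩
  have hk : ∀ k ∈ Finset.range (⌊T⌋₊ + 1), P (lo k ∪ hi k) ≤ 4 * E := by
    intro k hk
    have hkT : (k : ℝ) ≤ T := by
      rw [Finset.mem_range, Nat.lt_succ_iff, Nat.le_floor_iff hT] at hk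
      exact hk
    have hmono : ENNReal.ofReal (Real.exp (5 * ε ^ 2 * (((k : ℝ≥0) : ℝ) + 1) - ε * D
        + 3 * (m + 1))) ≤ E := by
      rw [hE]
      push_cast
      gcongr
    calc _ ≤ P (lo k) + P (hi k) := measure_union_le _ _
      _ ≤ 2 * E + 2 * E := add_le_add
          ((H.measure_first_window_le hp hq hpq hqp hε hε1 k).trans (by gcongr))
          ((H.measure_last_window_le hp hq hpq hqp hε hε1 k).trans (by gcongr))
      _ = _ := by rw [← add_mul]; norm_num
  calc _ ≤ P (⋃ k ∈ Finset.range (⌊T⌋₊ + 1), (lo k ∪ hi k)) := measure_mono hsub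
    _ ≤ ∑ k ∈ Finset.range (⌊T⌋₊ + 1), P (lo k ∪ hi k) := measure_biUnion_finset_le _ _
    _ ≤ ∑ _k ∈ Finset.range (⌊T⌋₊ + 1), 4 * E := Finset.sum_le_sum hk
    _ = ENNReal.ofReal ((⌊T⌋₊ + 1) * (4 * Real.exp (5 * ε ^ 2 * (T + 1) - ε * D
          + 3 * (m + 1 : ℕ)))) := by
        rw [Finset.sum_const, Finset.card_range, nsmul_eq_mul, ENNReal.ofReal_mul (by positivity),
          ENNReal.ofReal_mul (by norm_num), hE, ENNReal.ofReal_ofNat]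
        congr 1
        rw [← Nat.cast_succ, ENNReal.ofReal_natCast]
    _ ≤ _ := by
        refine ENNReal.ofReal_le_ofReal ?_
        have := Nat.floor_le hT
        have h2 := Real.exp_pos (5 * ε ^ 2 * (T + 1) - ε * D + 3 * (m + 1 : ℕ))
        nlinarith

/-- The second bound gives M ≤ √N, hence ε ≤ 1/2; the first gives log N ≤ (log N)^10 ≤ M and then M²
≥ 2 log N. -/
theorem eventually_log_bounds :
    ∀ᶠ N : ℕ in atTop, 2 ≤ Real.log N ∧ Real.log N ^ 10 ≤ √(N : ℝ) := by
  have h1 : ∀ᶠ N : ℕ in atTop, 2 ≤ Real.log N :=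
    (Real.tendsto_log_atTop.comp tendsto_natCast_atTop_atTop).eventually_ge_atTop 2
  have h2 : ∀ᶠ N : ℕ in atTop, ‖Real.log N ^ 20‖ ≤ 1 * ‖(N : ℝ)‖ :=
    tendsto_natCast_atTop_atTop.eventually
      ((Real.isLittleO_pow_log_id_atTop (n := 20)).bound one_pos)
  filter_upwards [h1, h2] with N hN1 hN2
  refine ⟨hN1, Real.le_sqrt_of_sq_le ?_⟩
  rw [one_mul, Real.norm_of_nonneg (by positivity), Real.norm_of_nonneg (by positivity)] at hN2
  rw [← pow_mul]
  exact hN2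

end ASEP

theorem mainTheorem7 (p q K : ℝ) (hp : 1 / 2 < p) (hp1 : p ≤ 1) (hq : q = 1 - p) (hK : 0 < K) :
    ∃ C : ℝ, 0 < C ∧
      ∀ (n : ℕ → ℕ), (∀ N : ℕ, 1 ≤ N → 1 ≤ n N ∧ n N ≤ N) →
      ∀ (Ω : ℕ → Type*) [∀ N, MeasurableSpace (Ω N)] (P : ∀ N, Measure (Ω N))
        [∀ N, IsProbabilityMeasure (P N)] (η : ∀ N, ℝ≥0 → Ω N → ASEP.Config (n N)),
        (∀ N : ℕ, 1 ≤ N → ASEP.IsASEP (P N) p q (ASEP.packed (n N)) (η N)) →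
        Tendsto (fun N : ℕ => P N {ω | ∀ t : ℝ≥0, (t : ℝ) ≤ K * N → ∀ i : Fin (n N),
            |(((η N t ω).1 i : ℤ) : ℝ) - (p - q) * t| ≤
              C * √(N : ℝ) * max (√(n N : ℝ)) (Real.log N ^ 10)})
          atTop (𝓝 1) := by
  -- With ε = M/(2√N), the quadratic term is at most (5/4)(K + 1)M² and 3n ≤ 3M². One more M² ≥ 2
  -- log N is kept as the gain, whence 4 = 3 + 1; the leading 2 cancels the one in ε.
  refine ⟨2 * (5 / 4 * (K + 1) + 4), by positivity, ?_⟩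
  intro n hn Ω _ P _ η H
  have hlim : Tendsto (fun N : ℕ => 1 - ENNReal.ofReal (4 * (K + 1) / N)) atTop (𝓝 1) := by
    have h1 : Tendsto (fun N : ℕ => ENNReal.ofReal (4 * (K + 1) / N)) atTop (𝓝 0) := by
      rw [← ENNReal.ofReal_zero]
      exact ENNReal.tendsto_ofReal (tendsto_const_div_atTop_nhds_zero_nat _)
    simpa using ENNReal.Tendsto.sub tendsto_const_nhds h1 (Or.inl ENNReal.one_ne_top)
  refine tendsto_of_tendsto_of_tendsto_of_le_of_le' hlim tendsto_const_nhds ?_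
    (Eventually.of_forall fun N => prob_le_one)
  filter_upwards [ASEP.eventually_log_bounds, eventually_ge_atTop 1] with N ⟨hL, hLN⟩ hN
  obtain ⟨hn1, hnN⟩ := hn N hN
  set M : ℝ := max (√(n N : ℝ)) (Real.log N ^ 10) with hM
  set G := {ω | ∀ t : ℝ≥0, (t : ℝ) ≤ K * N → ∀ i : Fin (n N),
    |(((η N t ω).1 i : ℤ) : ℝ) - (p - q) * t| ≤
      2 * (5 / 4 * (K + 1) + 4) * √(N : ℝ) * M} with hG
  have hN1 : (1 : ℝ) ≤ N := by exact_mod_cast hN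
  have hsN : 0 < √(N : ℝ) := Real.sqrt_pos.mpr (by linarith)
  have hsq : √(N : ℝ) ^ 2 = N := Real.sq_sqrt (by linarith)
  have hMn : (n N : ℝ) ≤ M ^ 2 := by
    rw [← Real.sq_sqrt (Nat.cast_nonneg (n N) : (0 : ℝ) ≤ n N)]
    gcongr
    exact le_max_left _ _
  have hM0 : 0 < M := lt_of_lt_of_le
    (Real.sqrt_pos.mpr (by exact_mod_cast hn1)) (le_max_left _ _)
  have hMN : M ≤ √(N : ℝ) := max_le (Real.sqrt_le_sqrt (by exact_mod_cast hnN)) hLN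
  have hML : 2 * Real.log N ≤ M ^ 2 := by
    have h1 : Real.log N ≤ Real.log N ^ 10 := le_self_pow₀ (by linarith) (by norm_num)
    have h2 : Real.log N ≤ M := h1.trans (le_max_right _ _)
    nlinarith
  have key := (H N hN).measure_exists_exceed_le hn1 (by linarith) (by linarith) (by linarith)
    (by linarith) (ε := M / (2 * √(N : ℝ))) (D := 2 * (5 / 4 * (K + 1) + 4) * √(N : ℝ) * M)
    (T := K * N) (by positivity) (by rw [div_le_iff₀ (by positivity)]; linarith) (by positivity)
  have hexp : 5 * (M / (2 * √(N : ℝ))) ^ 2 * (K * N + 1) -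
      M / (2 * √(N : ℝ)) * (2 * (5 / 4 * (K + 1) + 4) * √(N : ℝ) * M) + 3 * n N ≤
      -(2 * Real.log N) := by
    have e1 : M / (2 * √(N : ℝ)) * (2 * (5 / 4 * (K + 1) + 4) * √(N : ℝ) * M) =
        (5 / 4 * (K + 1) + 4) * M ^ 2 := by
      field_simp
    have e2 : 5 * (M / (2 * √(N : ℝ))) ^ 2 * (K * N + 1) ≤ 5 / 4 * (K + 1) * M ^ 2 := by
      rw [div_pow, mul_pow, hsq]
      calc _ ≤ 5 * (M ^ 2 / (2 ^ 2 * N)) * (K * N + N) := by gcongr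
        _ = _ := by field_simp; norm_num
    rw [e1]
    linarith
  -- A factor N from the windows against N⁻² from the exponential.
  have hbad : P N Gᶜ ≤ ENNReal.ofReal (4 * (K + 1) / N) := by
    refine key.trans (ENNReal.ofReal_le_ofReal ?_)
    calc _ ≤ 4 * (K * N + N) * Real.exp (-(2 * Real.log N)) := by gcongr
      _ = _ := by
        rw [Real.exp_neg, two_mul, Real.exp_add, Real.exp_log (by linarith)]
        field_simp
  -- Subadditivity suffices, so measurability of G, an uncountable intersection over times, is never
  -- required.
  have huniv : 1 ≤ P N G + P N Gᶜ := by
    rw [← measure_univ (μ := P N), ← Set.union_compl_self G]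
    exact measure_union_le _ _
  calc _ ≤ 1 - P N Gᶜ := tsub_le_tsub_left hbad 1
    _ ≤ _ := tsub_le_iff_right.mpr huniv
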